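/- **Optimal success probability of raising entanglement.** All Hilbert spaces are finite-dimensional. An SLOCC protocol consists of finitely many rounds of local measurements (with finitely many Kraus operators, possibly changing the local dimension) by one of two parties, each round depending on the earlier outcomes; it transforms a bipartite pure state $\Psi$ into an ensemble $\{p_m,\Psi_m\}$ of pure states with $\sum_m p_m=1$. An entanglement monotone is a real function $E$ of bipartite pure states with $\sum_m p_m E(\Psi_m)\le E(\Psi)$ for every $\Psi$ and every SLOCC protocol. Put $P(E\ge E_{\rm target})=\sum_{m:\,E(\Psi_m)\ge E_{\rm target}}p_m$. Let $\lambda_1^\downarrow(\Psi)\ge\lambda_2^\downarrow(\Psi)\ge\cdots$ be the Schmidt coefficients of $\Psi$, i.e. the eigenvalues of $\rho_B={\rm Tr}_A|\Psi\rangle\langle\Psi|$, continued by zeros. Let $E$ be an entanglement monotone, let $\Psi\in\mathbb C^a\otimes\mathbb C^b$ be a pure state of Schmidt rank $d$, suppose that $E$ is continuous on the pure states of $\mathbb C^a\otimes\mathbb C^b$, and let $E_{\rm target}$ be a real number not smaller than the minimum of $E$ (the value of $E$ on product states, which is $0$ in the usual normalisation). If there is a pure state $\Psi'\in\mathbb C^a\otimes\mathbb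 C^b$ of Schmidt rank at most $d$ with $E(\Psi')=E_{\rm target}$, then $$\sup_{\mathcal E_{\rm SLOCC}}P(E\ge E_{\rm target})=\max_{\Psi'}\ \min_{l\in\{1,\dots,d\}}\frac{\sum_{i=l}^d\lambda_i^\downarrow(\Psi)}{\sum_{i=l}^d\lambda_i^\downarrow(\Psi')},$$ where the supremum is over all SLOCC protocols applied to $\Psi$, the maximum, which is attained, is over the pure states $\Psi'\in\mathbb C^a\otimes\mathbb C^b$ of Schmidt rank at most $d$ with $E(\Psi')=E_{\rm target}$, and a ratio with denominator $0$ counts as $+\infty$. If there is no such $\Psi'$, then $P(E\ge E_{\rm target})=0$ for every SLOCC protocol applied to $\Psi$. -/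

import Mathlib

open scoped Kronecker Matrix

noncomputable section

namespace Entanglement

/-- Vectors of the bipartite Hilbert space `ℂᵃ ⊗ ℂᵇ`, in coordinates. -/
abbrev Vec (a b : ℕ) : Type := EuclideanSpace ℂ (Fin a × Fin b)

/-- Bipartite pure states: unit vectors of `ℂᵃ ⊗ ℂᵇ`, with the norm topology. -/
abbrev PureState (a b : ℕ) : Type := Metric.sphere (0 : Vec a b) 1

/-- `(K ⊗ 1) v`, an operator of Alice. -/
def applyA {a a' b : ℕ} (K : Matrix (Fin a') (Fin a) ℂ) (v : Vec a b) : Vec a' b :=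
  WithLp.toLp 2 ((K ⊗ₖ (1 : Matrix (Fin b) (Fin b) ℂ)) *ᵥ v.ofLp)

/-- `(1 ⊗ K) v`, an operator of Bob. -/
def applyB {a b b' : ℕ} (K : Matrix (Fin b') (Fin b) ℂ) (v : Vec a b) : Vec a b' :=
  WithLp.toLp 2 (((1 : Matrix (Fin a) (Fin a) ℂ) ⊗ₖ K) *ᵥ v.ofLp)

/-- The pure state `v / ‖v‖`. -/
def normalize {a b : ℕ} (v : Vec a b) (h : v ≠ 0) : PureState a b :=
  ⟨((‖v‖⁻¹ : ℝ) : ℂ) • v, by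
    have hv : ‖v‖ ≠ 0 := norm_ne_zero_iff.mpr h
    simp [norm_smul, hv]⟩

/-- Protocols of (stochastic) local operations and classical communication on a system with
local dimensions `a`, `b`. In each round one party performs a local measurement with finitely many
Kraus operators (which may change the local dimension); its outcome `k` is announced, and the rest
of the protocol may depend on it. Local unitaries, isometries, ancillas and the use of randomness
are special cases of such rounds. -/
inductive Protocol : ℕ → ℕ → Type
  | done {a b : ℕ} : Protocol a b
  | alice {a b n : ℕ} (a' : Fin n → ℕ) (K : (k : Fin n) → Matrix (Fin (a' k)) (Fin a) ℂ)
      (complete : ∑ k, (K k)ᴴ * K k = 1) (next : (k : Fin n) → Protocol (a' k) b) : Protocol a b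
  | bob {a b n : ℕ} (b' : Fin n → ℕ) (K : (k : Fin n) → Matrix (Fin (b' k)) (Fin b) ℂ)
      (complete : ∑ k, (K k)ᴴ * K k = 1) (next : (k : Fin n) → Protocol a (b' k)) : Protocol a b

/-- One outcome `(p_m, Ψ_m)` of a protocol; the outcome system may have new local dimensions. -/
structure Outcome where
  prob : ℝ
  dimA : ℕ
  dimB : ℕ
  state : PureState dimA dimB

open Classical in
/-- The outcomes of a protocol run on the (unnormalised) vector `v`. A branch that ends in the
vector `w`, the image of `v` under the product of the Kraus operators of the branch, has
probability `‖w‖²` and outcome state `w / ‖w‖`; branches of probability zero are dropped. -/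
def Protocol.outcomes : {a b : ℕ} → Protocol a b → Vec a b → List Outcome
  | a, b, .done, w => if h : w ≠ 0 then [⟨‖w‖ ^ 2, a, b, normalize w h⟩] else []
  | _, _, .alice (n := n) _ K _ next, v =>
      (List.finRange n).flatMap fun k => (next k).outcomes (applyA (K k) v)
  | _, _, .bob (n := n) _ K _ next, v =>
      (List.finRange n).flatMap fun k => (next k).outcomes (applyB (K k) v)

/-- A real-valued quantifier of bipartite pure states of all finite local dimensions. -/
abbrev Quantifier : Type := (a b : ℕ) → PureState a b → ℝ

/-- The mean `⟨E⟩ = ∑ₘ pₘ E(Ψₘ)` over the outcomes of a protocol run on `Ψ`. -/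
def mean (E : Quantifier) {a b : ℕ} (π : Protocol a b) (Ψ : PureState a b) : ℝ :=
  ((π.outcomes Ψ.1).map fun m => m.prob * E m.dimA m.dimB m.state).sum

/-- Entanglement monotone: the mean does not increase under any protocol. -/
def IsMonotone (E : Quantifier) : Prop :=
  ∀ (a b : ℕ) (π : Protocol a b) (Ψ : PureState a b), mean E π Ψ ≤ E a b Ψ

open Classical in
/-- The accumulated success probability `P(E ≥ t) = ∑ₘ pₘ` over all `m` with `E(Ψₘ) ≥ t`. -/
def successProb (E : Quantifier) (t : ℝ) {a b : ℕ} (π : Protocol a b) (Ψ : PureState a b) : ℝ :=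
  (((π.outcomes Ψ.1).filter fun m => t ≤ E m.dimA m.dimB m.state).map fun m => m.prob).sum

/-- The reduced density matrix `ρ_B = Tr_A |Ψ⟩⟨Ψ|`. -/
def reducedB {a b : ℕ} (Ψ : PureState a b) : Matrix (Fin b) (Fin b) ℂ :=
  Matrix.of fun j j' => ∑ i, Ψ.1 (i, j) * star (Ψ.1 (i, j'))

theorem reducedB_isHermitian {a b : ℕ} (Ψ : PureState a b) : (reducedB Ψ).IsHermitian := by
  ext j j'
  simp [reducedB, Matrix.conjTranspose_apply, mul_comm]

/-- The Schmidt rank. -/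
def schmidtRank {a b : ℕ} (Ψ : PureState a b) : ℕ := (reducedB Ψ).rank

/-- The Schmidt coefficients `λ↓` of `Ψ = ∑ᵢ √λᵢ |i i⟩`, that is, the eigenvalues of the reduced
state in descending order, with multiplicity. The index starts at `0`, and the sequence is
continued by zeros. -/
def schmidtCoeff {a b : ℕ} (Ψ : PureState a b) (i : ℕ) : ℝ :=
  if h : i < Fintype.card (Fin b) then (reducedB_isHermitian Ψ).eigenvalues₀ ⟨i, h⟩ else 0

/-- The tail sum of the first `d` Schmidt coefficients from index `l` on. -/
def schmidtTail {a b : ℕ} (d : ℕ) (Ψ : PureState a b) (l : ℕ) : ℝ :=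
  ∑ i ∈ Finset.Ico l d, schmidtCoeff Ψ i

/-- The ratios of the tail sums of `Ψ` and `Ψ'`, where `d` is the Schmidt rank of `Ψ`. A ratio with
denominator zero counts as `+∞` and so does not enter the minimum over `l`; the denominator for
`l = 0` is `1` when the Schmidt rank of `Ψ'` is at most `d`. -/
def tailRatios {a b : ℕ} (Ψ Ψ' : PureState a b) : Set ℝ :=
  {q | ∃ l < schmidtRank Ψ, schmidtTail (schmidtRank Ψ) Ψ' l ≠ 0 ∧
    q = schmidtTail (schmidtRank Ψ) Ψ l / schmidtTail (schmidtRank Ψ) Ψ' l}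

/-- The values of the minimum over `l` of the tail ratios, for the target states `Ψ'` with
`E(Ψ') = t` whose Schmidt rank does not exceed that of `Ψ`. -/
def targetValues (E : Quantifier) (t : ℝ) {a b : ℕ} (Ψ : PureState a b) : Set ℝ :=
  {r | ∃ Ψ' : PureState a b, schmidtRank Ψ' ≤ schmidtRank Ψ ∧ E a b Ψ' = t ∧
    IsLeast (tailRatios Ψ Ψ') r}

end Entanglement

end

open scoped Kronecker Matrix

noncomputable section

namespace Entanglement

/-! ### Local operators -/

/-! Both sides of the identity equal the largest `r` occurring in a compact set of pairs `(r, μ)`,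
called `feasible`: `μ` is a descending probability vector of length `d`, the state with Schmidt
vector `μ` has `E = t`, and `r` times each tail sum of `μ` is at most the corresponding tail sum of
`Ψ`. For fixed `μ` the largest such `r` is the minimum of the tail ratios, which yields the
right-hand side.

Two facts make `E` a function on the simplex. A monotone is invariant under norm-preserving local
partial isometries, so it depends only on the Schmidt vector (`IsMonotone.eq_hat_diagVec`). A local
diagonal measurement splits a Schmidt vector into any ensemble averaging to it, so `E` is concave
there (`IsMonotone.sum_mul_hat_diagVec_le`).

Upper bound. A tail sum is the squared distance to the vectors of rank at most `l` (Eckart–Young),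
hence does not increase on average (`sum_outcomes_schmidtTail_le`). Given a protocol with success
probability `p > 0`, average the Schmidt vectors of its successful outcomes. By concavity the
average has `E ≥ t`, and `p` times its tails is bounded by those of `Ψ`. Mixing in a product vector
shrinks the tails and, by the intermediate value theorem, reaches `E = t` exactly.

Lower bound. For a feasible `(r, μ)`, the vector `r μ + (1 - r) e` with `e` a vertex majorizes the
Schmidt vector of `Ψ`. Rado's theorem makes the latter a mixture of permuted copies, and one
measurement reaches the permuted `μ` with total probability `r` (`exists_success_ge`). -/

theorem applyA_eq {a a' b : ℕ} (K : Matrix (Fin a') (Fin a) ℂ) (v : Vec a b) :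
    applyA K v = Matrix.toEuclideanLin (K ⊗ₖ (1 : Matrix (Fin b) (Fin b) ℂ)) v := rfl

theorem applyB_eq {a b b' : ℕ} (K : Matrix (Fin b') (Fin b) ℂ) (v : Vec a b) :
    applyB K v = Matrix.toEuclideanLin ((1 : Matrix (Fin a) (Fin a) ℂ) ⊗ₖ K) v := rfl

theorem applyA_apply {a a' b : ℕ} (K : Matrix (Fin a') (Fin a) ℂ) (v : Vec a b)
    (i : Fin a') (j : Fin b) : applyA K v (i, j) = ∑ i', K i i' * v (i', j) := by
  simp [applyA, Matrix.mulVec, dotProduct, Fintype.sum_prod_type, Matrix.kroneckerMap_apply,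
    Matrix.one_apply]

theorem applyB_apply {a b b' : ℕ} (K : Matrix (Fin b') (Fin b) ℂ) (v : Vec a b)
    (i : Fin a) (j : Fin b') : applyB K v (i, j) = ∑ j', K j j' * v (i, j') := by
  simp [applyB, Matrix.mulVec, dotProduct, Fintype.sum_prod_type, Matrix.kroneckerMap_apply,
    Matrix.one_apply]

@[simp] theorem applyA_zero {a a' b : ℕ} (K : Matrix (Fin a') (Fin a) ℂ) :
    applyA K (0 : Vec a b) = 0 := by rw [applyA_eq, map_zero]

@[simp] theorem applyB_zero {a b b' : ℕ} (K : Matrix (Fin b') (Fin b) ℂ) :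
    applyB K (0 : Vec a b) = 0 := by rw [applyB_eq, map_zero]

theorem applyA_smul {a a' b : ℕ} (K : Matrix (Fin a') (Fin a) ℂ) (c : ℂ) (v : Vec a b) :
    applyA K (c • v) = c • applyA K v := by simp only [applyA_eq, map_smul]

theorem applyB_smul {a b b' : ℕ} (K : Matrix (Fin b') (Fin b) ℂ) (c : ℂ) (v : Vec a b) :
    applyB K (c • v) = c • applyB K v := by simp only [applyB_eq, map_smul]

theorem applyA_sub {a a' b : ℕ} (K : Matrix (Fin a') (Fin a) ℂ) (v w : Vec a b) :
    applyA K (v - w) = applyA K v - applyA K w := by simp only [applyA_eq, map_sub]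

theorem applyB_sub {a b b' : ℕ} (K : Matrix (Fin b') (Fin b) ℂ) (v w : Vec a b) :
    applyB K (v - w) = applyB K v - applyB K w := by simp only [applyB_eq, map_sub]

theorem applyA_mul {a a' a'' b : ℕ} (K : Matrix (Fin a'') (Fin a') ℂ)
    (L : Matrix (Fin a') (Fin a) ℂ) (v : Vec a b) :
    applyA (K * L) v = applyA K (applyA L v) := by
  ext ⟨i, j⟩
  simp only [applyA_apply, Matrix.mul_apply, Finset.sum_mul, Finset.mul_sum, mul_assoc]
  exact Finset.sum_comm

theorem applyB_mul {a b b' b'' : ℕ} (K : Matrix (Fin b'') (Fin b') ℂ)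
    (L : Matrix (Fin b') (Fin b) ℂ) (v : Vec a b) :
    applyB (K * L) v = applyB K (applyB L v) := by
  ext ⟨i, j⟩
  simp only [applyB_apply, Matrix.mul_apply, Finset.sum_mul, Finset.mul_sum, mul_assoc]
  exact Finset.sum_comm

@[simp] theorem applyA_one {a b : ℕ} (v : Vec a b) : applyA 1 v = v := by
  ext ⟨i, j⟩; simp [applyA_apply, Matrix.one_apply]

@[simp] theorem applyB_one {a b : ℕ} (v : Vec a b) : applyB 1 v = v := by
  ext ⟨i, j⟩; simp [applyB_apply, Matrix.one_apply]

theorem norm_sq_toEuclideanLin {m n : Type*} [Fintype m] [DecidableEq m] [Fintype n]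
    [DecidableEq n] (A : Matrix m n ℂ) (v : EuclideanSpace ℂ n) :
    ‖Matrix.toEuclideanLin A v‖ ^ 2 = RCLike.re (inner ℂ v (Matrix.toEuclideanLin (Aᴴ * A) v)) := by
  have h : Matrix.toEuclideanLin (Aᴴ * A) v =
      Matrix.toEuclideanLin Aᴴ (Matrix.toEuclideanLin A v) := by
    simp [Matrix.toLpLin_apply]
  rw [h, Matrix.toEuclideanLin_conjTranspose_eq_adjoint, LinearMap.adjoint_inner_right,
    inner_self_eq_norm_sq]

theorem sum_norm_sq_toEuclideanLin {ι n : Type*} {m : ι → Type*} [Fintype ι] [∀ k, Fintype (m k)]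
    [∀ k, DecidableEq (m k)] [Fintype n] [DecidableEq n] (A : ∀ k, Matrix (m k) n ℂ)
    (hA : ∑ k, (A k)ᴴ * A k = 1) (v : EuclideanSpace ℂ n) :
    ∑ k, ‖Matrix.toEuclideanLin (A k) v‖ ^ 2 = ‖v‖ ^ 2 := by
  simp only [norm_sq_toEuclideanLin]
  rw [← map_sum, ← inner_sum, ← LinearMap.sum_apply, ← map_sum, hA]
  simp [← Complex.ofReal_pow]

theorem sum_norm_sq_applyA {a b n : ℕ} {a' : Fin n → ℕ}
    (K : (k : Fin n) → Matrix (Fin (a' k)) (Fin a) ℂ) (hK : ∑ k, (K k)ᴴ * K k = 1) (v : Vec a b) :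
    ∑ k, ‖applyA (K k) v‖ ^ 2 = ‖v‖ ^ 2 := by
  simp only [applyA_eq]
  refine sum_norm_sq_toEuclideanLin (fun k => K k ⊗ₖ (1 : Matrix (Fin b) (Fin b) ℂ)) ?_ v
  simp only [Matrix.conjTranspose_kronecker, ← Matrix.mul_kronecker_mul, Matrix.conjTranspose_one,
    mul_one]
  rw [← Matrix.one_kronecker_one, ← hK]
  ext ⟨i, j⟩ ⟨i', j'⟩
  simp [Matrix.sum_apply, Finset.sum_mul]

theorem sum_norm_sq_applyB {a b n : ℕ} {b' : Fin n → ℕ}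
    (K : (k : Fin n) → Matrix (Fin (b' k)) (Fin b) ℂ) (hK : ∑ k, (K k)ᴴ * K k = 1) (v : Vec a b) :
    ∑ k, ‖applyB (K k) v‖ ^ 2 = ‖v‖ ^ 2 := by
  simp only [applyB_eq]
  refine sum_norm_sq_toEuclideanLin (fun k => (1 : Matrix (Fin a) (Fin a) ℂ) ⊗ₖ K k) ?_ v
  simp only [Matrix.conjTranspose_kronecker, ← Matrix.mul_kronecker_mul, Matrix.conjTranspose_one,
    mul_one]
  rw [← Matrix.one_kronecker_one, ← hK]
  ext ⟨i, j⟩ ⟨i', j'⟩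
  simp [Matrix.sum_apply, Finset.mul_sum]

/-! ### Sums over the outcomes of a protocol -/

theorem sum_map_flatMap_finRange {α : Type*} {n : ℕ} (f : Fin n → List α) (g : α → ℝ) :
    (((List.finRange n).flatMap f).map g).sum = ∑ k, ((f k).map g).sum := by
  rw [List.map_flatMap, List.flatMap_def, List.sum_flatten, List.map_map, Fin.sum_univ_def]
  rfl

/-- The quantifier extended to unnormalised vectors by `‖v‖² E(v / ‖v‖)`. -/
def hat (E : Quantifier) {a b : ℕ} (v : Vec a b) : ℝ :=
  open Classical in if h : v ≠ 0 then ‖v‖ ^ 2 * E a b (normalize v h) else 0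

@[simp] theorem hat_zero (E : Quantifier) {a b : ℕ} : hat E (0 : Vec a b) = 0 := by simp [hat]

theorem normalize_coe {a b : ℕ} (Ψ : PureState a b) (h : Ψ.1 ≠ 0) : normalize Ψ.1 h = Ψ := by
  apply Subtype.ext
  have : ‖Ψ.1‖ = 1 := by simp
  simp [normalize]

theorem PureState.ne_zero {a b : ℕ} (Ψ : PureState a b) : Ψ.1 ≠ 0 :=
  ne_zero_of_mem_unit_sphere Ψ

theorem PureState.norm_eq {a b : ℕ} (Ψ : PureState a b) : ‖Ψ.1‖ = 1 := by simp

theorem hat_coe (E : Quantifier) {a b : ℕ} (Ψ : PureState a b) : hat E Ψ.1 = E a b Ψ := by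
  simp [hat, Ψ.ne_zero, normalize_coe]

theorem normalize_smul {a b : ℕ} {c : ℝ} (hc : 0 < c) (v : Vec a b) (h : v ≠ 0)
    (h' : (c : ℂ) • v ≠ 0) : normalize ((c : ℂ) • v) h' = normalize v h := by
  apply Subtype.ext
  simp only [normalize, norm_smul, smul_smul]
  congr 1
  rw [← Complex.ofReal_mul]
  congr 1
  simp only [Complex.norm_real, Real.norm_eq_abs, abs_of_pos hc]
  field_simp

theorem hat_smul (E : Quantifier) {a b : ℕ} {c : ℝ} (hc : 0 ≤ c) (v : Vec a b) :
    hat E ((c : ℂ) • v) = c ^ 2 * hat E v := by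
  rcases hc.eq_or_lt with rfl | hc
  · simp
  by_cases h : v = 0
  · simp [h]
  have h' : (c : ℂ) • v ≠ 0 := smul_ne_zero (by exact_mod_cast hc.ne') h
  simp only [hat, ne_eq, h, h', not_false_eq_true, dif_pos]
  rw [normalize_smul hc v h h', norm_smul]
  simp only [Complex.norm_real, Real.norm_eq_abs, abs_of_pos hc]
  ring

theorem sum_outcomes_done (E : Quantifier) {a b : ℕ} (v : Vec a b) :
    ((Protocol.done.outcomes v).map fun m => m.prob * E m.dimA m.dimB m.state).sum = hat E v := by
  by_cases h : v = 0 <;> simp [Protocol.outcomes, hat, h]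

theorem eq_smul_pureState {a b : ℕ} {v : Vec a b} (h : v ≠ 0) :
    v = ((‖v‖ : ℝ) : ℂ) • (normalize v h).1 := by
  have : ((‖v‖ : ℝ) : ℂ) ≠ 0 := by simpa using h
  simp [normalize, smul_smul, this]

namespace IsMonotone

variable {E : Quantifier}

/-- Homogenised one-round form of monotonicity: `hat` carries the probability of each branch, so
unnormalised vectors can be used. Later consequences of monotonicity go through this lemma or its
counterpart for Bob. -/
theorem sum_hat_applyA_le (hE : IsMonotone E) {a b n : ℕ} {a' : Fin n → ℕ}
    (K : (k : Fin n) → Matrix (Fin (a' k)) (Fin a) ℂ) (hK : ∑ k, (K k)ᴴ * K k = 1) (v : Vec a b) :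
    ∑ k, hat E (applyA (K k) v) ≤ hat E v := by
  by_cases h : v = 0
  · simp [h]
  have := hE a b (.alice a' K hK fun _ => .done) (normalize v h)
  rw [mean, Protocol.outcomes, sum_map_flatMap_finRange] at this
  simp only [sum_outcomes_done] at this
  rw [eq_smul_pureState h]
  simp only [applyA_smul, hat_smul E (norm_nonneg v), hat_coe, ← Finset.mul_sum]
  gcongr

theorem sum_hat_applyB_le (hE : IsMonotone E) {a b n : ℕ} {b' : Fin n → ℕ}
    (K : (k : Fin n) → Matrix (Fin (b' k)) (Fin b) ℂ) (hK : ∑ k, (K k)ᴴ * K k = 1) (v : Vec a b) :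
    ∑ k, hat E (applyB (K k) v) ≤ hat E v := by
  by_cases h : v = 0
  · simp [h]
  have := hE a b (.bob b' K hK fun _ => .done) (normalize v h)
  rw [mean, Protocol.outcomes, sum_map_flatMap_finRange] at this
  simp only [sum_outcomes_done] at this
  rw [eq_smul_pureState h]
  simp only [applyB_smul, hat_smul E (norm_nonneg v), hat_coe, ← Finset.mul_sum]
  gcongr

end IsMonotone

/-! ### Invariance of monotones under norm-preserving local partial isometries -/

/-- The measurement consisting of a partial isometry and the projection onto its kernel. -/
def dichotomy {a a' : ℕ} (K : Matrix (Fin a') (Fin a) ℂ) :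
    (k : Fin 2) → Matrix (Fin (![a', a] k)) (Fin a) ℂ
  | 0 => K
  | 1 => 1 - Kᴴ * K

/-- The hypothesis makes `Kᴴ * K` an orthogonal projection, so its complement is the missing Kraus
operator. -/
theorem dichotomy_complete {a a' : ℕ} {K : Matrix (Fin a') (Fin a) ℂ} (hK : K * Kᴴ * K = K) :
    ∑ k, (dichotomy K k)ᴴ * dichotomy K k = 1 := by
  have h : Kᴴ * K * (Kᴴ * K) = Kᴴ * K := by
    rw [Matrix.mul_assoc, ← Matrix.mul_assoc K, hK]
  have h' : Kᴴ * K + (1 - Kᴴ * K)ᴴ * (1 - Kᴴ * K) = 1 := by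
    simp only [Matrix.conjTranspose_sub, Matrix.conjTranspose_one, Matrix.conjTranspose_mul,
      Matrix.conjTranspose_conjTranspose, sub_mul, mul_sub, one_mul, mul_one, h]
    abel
  rw [Fin.sum_univ_two]
  exact h'

section PartialIsometry

variable {a b a' b' : ℕ}

theorem norm_sq_dichotomyA {K : Matrix (Fin a') (Fin a) ℂ} (hK : K * Kᴴ * K = K)
    (v : Vec a b) : ‖applyA K v‖ ^ 2 + ‖applyA (1 - Kᴴ * K) v‖ ^ 2 = ‖v‖ ^ 2 := by
  have h := sum_norm_sq_applyA _ (dichotomy_complete hK) v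
  rw [Fin.sum_univ_two] at h
  exact h

theorem applyA_compl_eq_zero {K : Matrix (Fin a') (Fin a) ℂ} (hK : K * Kᴴ * K = K)
    {v : Vec a b} (hv : ‖applyA K v‖ = ‖v‖) : applyA (1 - Kᴴ * K) v = 0 := by
  have h := norm_sq_dichotomyA hK v
  rwa [hv, add_eq_left, sq_eq_zero_iff, norm_eq_zero] at h

theorem applyA_conjTranspose_applyA {K : Matrix (Fin a') (Fin a) ℂ} (hK : K * Kᴴ * K = K)
    {v : Vec a b} (hv : ‖applyA K v‖ = ‖v‖) : applyA Kᴴ (applyA K v) = v := by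
  have h := applyA_compl_eq_zero hK hv
  have h2 : applyA (1 - Kᴴ * K) v = v - applyA Kᴴ (applyA K v) := by
    rw [← applyA_mul]
    ext ⟨i, j⟩
    simp [applyA_apply, sub_mul, Finset.sum_sub_distrib, Matrix.one_apply]
  rw [h2, sub_eq_zero] at h
  exact h.symm

theorem norm_sq_dichotomyB {K : Matrix (Fin b') (Fin b) ℂ} (hK : K * Kᴴ * K = K)
    (v : Vec a b) : ‖applyB K v‖ ^ 2 + ‖applyB (1 - Kᴴ * K) v‖ ^ 2 = ‖v‖ ^ 2 := by
  have h := sum_norm_sq_applyB _ (dichotomy_complete hK) v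
  rw [Fin.sum_univ_two] at h
  exact h

theorem applyB_compl_eq_zero {K : Matrix (Fin b') (Fin b) ℂ} (hK : K * Kᴴ * K = K)
    {v : Vec a b} (hv : ‖applyB K v‖ = ‖v‖) : applyB (1 - Kᴴ * K) v = 0 := by
  have h := norm_sq_dichotomyB hK v
  rwa [hv, add_eq_left, sq_eq_zero_iff, norm_eq_zero] at h

theorem applyB_conjTranspose_applyB {K : Matrix (Fin b') (Fin b) ℂ} (hK : K * Kᴴ * K = K)
    {v : Vec a b} (hv : ‖applyB K v‖ = ‖v‖) : applyB Kᴴ (applyB K v) = v := by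
  have h := applyB_compl_eq_zero hK hv
  have h2 : applyB (1 - Kᴴ * K) v = v - applyB Kᴴ (applyB K v) := by
    rw [← applyB_mul]
    ext ⟨i, j⟩
    simp [applyB_apply, sub_mul, Finset.sum_sub_distrib, Matrix.one_apply]
  rw [h2, sub_eq_zero] at h
  exact h.symm

theorem conjTranspose_partialIsometry {m n : ℕ} {K : Matrix (Fin m) (Fin n) ℂ}
    (hK : K * Kᴴ * K = K) : Kᴴ * Kᴴᴴ * Kᴴ = Kᴴ := by
  have := congrArg Matrix.conjTranspose hK
  simpa [Matrix.conjTranspose_mul, Matrix.mul_assoc] using this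

variable {E : Quantifier}

theorem IsMonotone.hat_applyA_le (hE : IsMonotone E) {K : Matrix (Fin a') (Fin a) ℂ}
    (hK : K * Kᴴ * K = K) {v : Vec a b} (hv : ‖applyA K v‖ = ‖v‖) :
    hat E (applyA K v) ≤ hat E v := by
  have h := hE.sum_hat_applyA_le _ (dichotomy_complete hK) v
  rw [Fin.sum_univ_two] at h
  have h' : hat E (applyA K v) + hat E (applyA (1 - Kᴴ * K) v) ≤ hat E v := h
  rwa [applyA_compl_eq_zero hK hv, hat_zero, add_zero] at h'

theorem IsMonotone.hat_applyB_le (hE : IsMonotone E) {K : Matrix (Fin b') (Fin b) ℂ}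
    (hK : K * Kᴴ * K = K) {v : Vec a b} (hv : ‖applyB K v‖ = ‖v‖) :
    hat E (applyB K v) ≤ hat E v := by
  have h := hE.sum_hat_applyB_le _ (dichotomy_complete hK) v
  rw [Fin.sum_univ_two] at h
  have h' : hat E (applyB K v) + hat E (applyB (1 - Kᴴ * K) v) ≤ hat E v := h
  rwa [applyB_compl_eq_zero hK hv, hat_zero, add_zero] at h'

/-- Monotones are invariant under local partial isometries that preserve the norm. -/
theorem IsMonotone.hat_applyA (hE : IsMonotone E) {K : Matrix (Fin a') (Fin a) ℂ}
    (hK : K * Kᴴ * K = K) {v : Vec a b} (hv : ‖applyA K v‖ = ‖v‖) :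
    hat E (applyA K v) = hat E v := by
  have h := applyA_conjTranspose_applyA hK hv
  refine le_antisymm (hE.hat_applyA_le hK hv) ?_
  -- The adjoint is a partial isometry that takes the image back to `v`, which gives the reverse
  -- inequality.
  have := hE.hat_applyA_le (conjTranspose_partialIsometry hK) (v := applyA K v) (by rw [h, hv])
  rwa [h] at this

theorem IsMonotone.hat_applyB (hE : IsMonotone E) {K : Matrix (Fin b') (Fin b) ℂ}
    (hK : K * Kᴴ * K = K) {v : Vec a b} (hv : ‖applyB K v‖ = ‖v‖) :
    hat E (applyB K v) = hat E v := by
  have h := applyB_conjTranspose_applyB hK hv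
  refine le_antisymm (hE.hat_applyB_le hK hv) ?_
  have := hE.hat_applyB_le (conjTranspose_partialIsometry hK) (v := applyB K v) (by rw [h, hv])
  rwa [h] at this

theorem norm_applyA_of_isometry {K : Matrix (Fin a') (Fin a) ℂ} (hK : Kᴴ * K = 1) (v : Vec a b) :
    ‖applyA K v‖ = ‖v‖ := by
  have := sum_norm_sq_applyA (fun _ : Fin 1 => K) (by simpa using hK) v
  simpa using this

theorem norm_applyB_of_isometry {K : Matrix (Fin b') (Fin b) ℂ} (hK : Kᴴ * K = 1) (v : Vec a b) :
    ‖applyB K v‖ = ‖v‖ := by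
  have := sum_norm_sq_applyB (fun _ : Fin 1 => K) (by simpa using hK) v
  simpa using this

theorem partialIsometry_of_isometry {m n : ℕ} {K : Matrix (Fin m) (Fin n) ℂ}
    (hK : Kᴴ * K = 1) : K * Kᴴ * K = K := by
  rw [Matrix.mul_assoc, hK, Matrix.mul_one]

end PartialIsometry

/-! ### Schmidt coefficients -/

/-- The reduced matrix of an unnormalised vector. -/
def gram {a b : ℕ} (v : Vec a b) : Matrix (Fin b) (Fin b) ℂ :=
  Matrix.of fun j j' => ∑ i, v (i, j) * star (v (i, j'))

theorem gram_apply {a b : ℕ} (v : Vec a b) (j j' : Fin b) :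
    gram v j j' = ∑ i, v (i, j) * star (v (i, j')) := rfl

theorem gram_eq_mul {a b : ℕ} (v : Vec a b) :
    gram v = (Matrix.of fun j i => v (i, j)) * (Matrix.of fun j i => v (i, j))ᴴ := by
  ext j j'
  simp [gram_apply, Matrix.mul_apply]

theorem gram_applyB {a b b' : ℕ} (K : Matrix (Fin b') (Fin b) ℂ) (v : Vec a b) :
    gram (applyB K v) = K * gram v * Kᴴ := by
  have h : (Matrix.of fun j i => applyB K v (i, j)) = K * Matrix.of fun j i => v (i, j) := by
    ext j i
    simp [applyB_apply, Matrix.mul_apply]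
  rw [gram_eq_mul, gram_eq_mul, h, Matrix.conjTranspose_mul]
  simp only [Matrix.mul_assoc]

theorem sum_norm_sq_column {a b : ℕ} (v : Vec a b) (j : Fin b) :
    ((∑ i, ‖v (i, j)‖ ^ 2 : ℝ) : ℂ) = gram v j j := by
  simp [gram_apply, Complex.mul_conj, Complex.normSq_eq_norm_sq]

theorem norm_sq_eq_sum {a b : ℕ} (v : Vec a b) : ‖v‖ ^ 2 = ∑ j, ∑ i, ‖v (i, j)‖ ^ 2 := by
  rw [EuclideanSpace.norm_sq_eq, Fintype.sum_prod_type, Finset.sum_comm]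

theorem exists_schmidt_unitary {a b : ℕ} (Ψ : PureState a b) :
    ∃ U : Matrix (Fin b) (Fin b) ℂ, Uᴴ * U = 1 ∧
      gram (applyB U Ψ.1) = Matrix.diagonal fun k : Fin b => (schmidtCoeff Ψ k : ℂ) := by
  have hA := reducedB_isHermitian Ψ
  let Q : Matrix (Fin b) (Fin b) ℂ := hA.eigenvectorUnitary
  have hQ : Q * star Q = 1 := Unitary.coe_mul_star_self _
  -- `eigenvalues` is `eigenvalues₀` composed with the inverse of an arbitrary equivalence; `σ`
  -- undoes it, so the diagonal comes out in descending order.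
  let σ : Fin b ≃ Fin b :=
    (finCongr (Fintype.card_fin b).symm).trans (Fintype.equivOfCardEq (Fintype.card_fin _))
  have hspec : star Q * reducedB Ψ * Q = Matrix.diagonal (RCLike.ofReal ∘ hA.eigenvalues) := by
    rw [← hA.conjStarAlgAut_star_eigenvectorUnitary, Unitary.conjStarAlgAut_star_apply]
  refine ⟨(star Q).submatrix σ id, ?_, ?_⟩
  · rw [Matrix.conjTranspose_submatrix, Matrix.submatrix_mul_equiv, Matrix.star_eq_conjTranspose,
      Matrix.conjTranspose_conjTranspose, ← Matrix.star_eq_conjTranspose, hQ]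
    simp
  · rw [gram_applyB, Matrix.conjTranspose_submatrix, Matrix.star_eq_conjTranspose,
      Matrix.conjTranspose_conjTranspose, ← Matrix.star_eq_conjTranspose]
    have h : (star Q).submatrix σ id * gram Ψ.1 * Q.submatrix id σ =
        (star Q * reducedB Ψ * Q).submatrix σ σ := by
      ext i j
      simp only [Matrix.mul_apply, Matrix.submatrix_apply, id]
      rfl
    rw [h, hspec, Matrix.submatrix_diagonal_equiv]
    congr 1
    ext k
    have hk : (k : ℕ) < Fintype.card (Fin b) := by simp
    simp only [Function.comp_apply, schmidtCoeff, hk, dif_pos, Matrix.IsHermitian.eigenvalues, σ,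
      Equiv.trans_apply, Equiv.symm_apply_apply]
    rfl

theorem schmidtCoeff_eq_zero_of_le {a b : ℕ} (Ψ : PureState a b) {i : ℕ} (hi : b ≤ i) :
    schmidtCoeff Ψ i = 0 := by
  simp [schmidtCoeff, hi]

theorem exists_schmidt_columns {a b : ℕ} (Ψ : PureState a b) :
    ∃ U : Matrix (Fin b) (Fin b) ℂ, Uᴴ * U = 1 ∧
      gram (applyB U Ψ.1) = Matrix.diagonal (fun k : Fin b => (schmidtCoeff Ψ k : ℂ)) ∧
      ∀ k : Fin b, ∑ i, ‖applyB U Ψ.1 (i, k)‖ ^ 2 = schmidtCoeff Ψ k := by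
  obtain ⟨U, hU, hg⟩ := exists_schmidt_unitary Ψ
  refine ⟨U, hU, hg, fun k => ?_⟩
  have := sum_norm_sq_column (applyB U Ψ.1) k
  rw [hg, Matrix.diagonal_apply_eq] at this
  exact_mod_cast this

theorem schmidtCoeff_nonneg {a b : ℕ} (Ψ : PureState a b) (i : ℕ) : 0 ≤ schmidtCoeff Ψ i := by
  rcases lt_or_ge i b with hi | hi
  · obtain ⟨U, -, -, h⟩ := exists_schmidt_columns Ψ
    rw [← h ⟨i, hi⟩]
    positivity
  · rw [schmidtCoeff_eq_zero_of_le Ψ hi]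

theorem schmidtCoeff_antitone {a b : ℕ} (Ψ : PureState a b) : Antitone (schmidtCoeff Ψ) := by
  intro i j hij
  rcases lt_or_ge j b with hj | hj
  · have hj' : j < Fintype.card (Fin b) := by simpa
    have hi' : i < Fintype.card (Fin b) := hij.trans_lt hj'
    simp only [schmidtCoeff, hi', hj', dif_pos]
    exact (reducedB_isHermitian Ψ).eigenvalues₀_antitone (by simpa using hij)
  · rw [schmidtCoeff_eq_zero_of_le Ψ hj]
    exact schmidtCoeff_nonneg Ψ i

theorem sum_schmidtCoeff {a b : ℕ} (Ψ : PureState a b) :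
    ∑ i ∈ Finset.range b, schmidtCoeff Ψ i = 1 := by
  obtain ⟨U, hU, -, h⟩ := exists_schmidt_columns Ψ
  rw [Finset.sum_range]
  simp only [← h]
  rw [← norm_sq_eq_sum, norm_applyB_of_isometry hU, Ψ.norm_eq, one_pow]

theorem schmidtRank_le_right {a b : ℕ} (Ψ : PureState a b) : schmidtRank Ψ ≤ b :=
  (reducedB Ψ).rank_le_width

theorem schmidtRank_le_left {a b : ℕ} (Ψ : PureState a b) : schmidtRank Ψ ≤ a := by
  change (gram Ψ.1).rank ≤ a
  rw [gram_eq_mul]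
  refine (Matrix.rank_mul_le_left _ _).trans ?_
  simpa using Matrix.rank_le_width (Matrix.of fun j i => Ψ.1 (i, j))

theorem schmidtRank_eq_card {a b : ℕ} (Ψ : PureState a b) :
    schmidtRank Ψ = (Finset.univ.filter fun k : Fin b => schmidtCoeff Ψ k ≠ 0).card := by
  obtain ⟨U, hU, hg⟩ := exists_schmidt_unitary Ψ
  have hu : IsUnit U.det := Matrix.isUnit_det_of_left_inverse hU
  have hu' : IsUnit (Uᴴ).det := Matrix.isUnit_det_of_right_inverse hU
  have h : (gram (applyB U Ψ.1)).rank = schmidtRank Ψ := by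
    rw [gram_applyB, Matrix.rank_mul_eq_left_of_isUnit_det _ _ hu',
      Matrix.rank_mul_eq_right_of_isUnit_det _ _ hu]
    rfl
  rw [← h, hg, Matrix.rank_diagonal, Fintype.card_subtype]
  simp

/-- A descending nonnegative sequence has its nonzero terms in an initial segment, and their number
is the rank. -/
theorem schmidtCoeff_ne_zero_iff {a b : ℕ} (Ψ : PureState a b) (i : ℕ) :
    schmidtCoeff Ψ i ≠ 0 ↔ i < schmidtRank Ψ := by
  have hanti := schmidtCoeff_antitone Ψ
  have hnn := schmidtCoeff_nonneg Ψ
  rcases lt_or_ge i b with hi | hi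
  · rw [schmidtRank_eq_card]
    constructor
    · intro h
      have hsub : Finset.Iic (⟨i, hi⟩ : Fin b) ⊆
          Finset.univ.filter fun k : Fin b => schmidtCoeff Ψ k ≠ 0 := by
        intro k hk
        have hk' : (k : ℕ) ≤ i := by simpa [Fin.le_def] using hk
        simpa using (((hnn i).lt_of_ne' h).trans_le (hanti hk')).ne'
      have := Finset.card_le_card hsub
      rw [Fin.card_Iic] at this
      exact this
    · intro h h0
      have hsub : (Finset.univ.filter fun k : Fin b => schmidtCoeff Ψ k ≠ 0) ⊆
          Finset.Iio (⟨i, hi⟩ : Fin b) := by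
        intro k hk
        by_contra hk'
        have hk' : i ≤ (k : ℕ) := by simpa [Fin.le_def] using hk'
        have hk0 : schmidtCoeff Ψ k ≠ 0 := by simpa using hk
        exact hk0 (le_antisymm (h0 ▸ hanti hk') (hnn k))
      have := Finset.card_le_card hsub
      rw [Fin.card_Iio] at this
      exact absurd h (by simpa using this)
  · simp only [schmidtCoeff_eq_zero_of_le Ψ hi, ne_eq, not_true_eq_false, false_iff, not_lt]
    exact (schmidtRank_le_right Ψ).trans hi

theorem schmidtCoeff_eq_zero_iff {a b : ℕ} (Ψ : PureState a b) (i : ℕ) :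
    schmidtCoeff Ψ i = 0 ↔ schmidtRank Ψ ≤ i := by
  rw [← not_lt, ← schmidtCoeff_ne_zero_iff, not_not]

/-! ### The Eckart–Young theorem -/

/-- The vectors whose coefficient matrix has rank at most `l`. -/
def RankLE {a b : ℕ} (l : ℕ) (v : Vec a b) : Prop :=
  ∃ (X : Matrix (Fin a) (Fin l) ℂ) (Y : Matrix (Fin l) (Fin b) ℂ), ∀ i j, v (i, j) = (X * Y) i j

theorem RankLE.applyA {a a' b l : ℕ} {v : Vec a b} (h : RankLE l v)
    (K : Matrix (Fin a') (Fin a) ℂ) : RankLE l (applyA K v) := by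
  obtain ⟨X, Y, h⟩ := h
  refine ⟨K * X, Y, fun i j => ?_⟩
  rw [applyA_apply, Matrix.mul_assoc, Matrix.mul_apply]
  simp only [h]

theorem RankLE.applyB {a b b' l : ℕ} {v : Vec a b} (h : RankLE l v)
    (K : Matrix (Fin b') (Fin b) ℂ) : RankLE l (applyB K v) := by
  obtain ⟨X, Y, h⟩ := h
  refine ⟨X, Y * Kᵀ, fun i j => ?_⟩
  rw [applyB_apply, ← Matrix.mul_assoc, Matrix.mul_apply]
  simp only [h, Matrix.transpose_apply, mul_comm]

theorem RankLE.smul {a b l : ℕ} {v : Vec a b} (h : RankLE l v) (c : ℂ) : RankLE l (c • v) := by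
  obtain ⟨X, Y, h⟩ := h
  refine ⟨c • X, Y, fun i j => ?_⟩
  simp [h]

theorem sum_Ico_eq_sum_fin (l b : ℕ) (f : ℕ → ℝ) :
    ∑ k ∈ Finset.Ico l b, f k = ∑ k : Fin b, if l ≤ (k : ℕ) then f k else 0 := by
  rw [Fin.sum_univ_eq_sum_range (fun k => if l ≤ k then f k else 0) b, ← Finset.sum_filter]
  refine Finset.sum_congr ?_ fun _ _ => rfl
  ext k
  simp only [Finset.mem_Ico, Finset.mem_filter, Finset.mem_range]
  tauto

/-- Bathtub principle: the weights `1 - w k` lie in `[0, 1]` and have total at least `b - l`, so the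
cheapest choice puts them on the smallest entries, those from index `l` on. The proof compares each
term with the threshold `c l`. -/
theorem sum_Ico_le_sum_mul {b l : ℕ} {c : ℕ → ℝ} (hc : Antitone c) (hc0 : ∀ i, 0 ≤ c i)
    {w : Fin b → ℝ} (hw0 : ∀ k, 0 ≤ w k) (hw1 : ∀ k, w k ≤ 1) (hw : ∑ k, w k ≤ l) :
    ∑ k ∈ Finset.Ico l b, c k ≤ ∑ k : Fin b, c k * (1 - w k) := by
  rcases lt_or_ge b l with hl | hl
  · rw [Finset.Ico_eq_empty (by omega), Finset.sum_empty]
    exact Finset.sum_nonneg fun k _ => mul_nonneg (hc0 k) (by linarith [hw1 k])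
  have hcount : ∑ k : Fin b, (if l ≤ (k : ℕ) then (1 : ℝ) else 0) = b - l := by
    rw [← sum_Ico_eq_sum_fin l b fun _ => 1]
    simp [Nat.cast_sub hl]
  have hterm : ∀ k : Fin b, c l * (1 - w k - if l ≤ (k : ℕ) then 1 else 0) ≤
      c k * (1 - w k) - if l ≤ (k : ℕ) then c k else 0 := by
    intro k
    split_ifs with h
    · nlinarith [mul_le_mul_of_nonneg_right (hc h) (hw0 k)]
    · nlinarith [mul_le_mul_of_nonneg_right (hc (not_le.mp h).le) (sub_nonneg.mpr (hw1 k))]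
  have hsum := Finset.sum_le_sum fun k (_ : k ∈ Finset.univ) => hterm k
  rw [← Finset.mul_sum, Finset.sum_sub_distrib, Finset.sum_sub_distrib, Finset.sum_sub_distrib,
    hcount, ← sum_Ico_eq_sum_fin l b c] at hsum
  simp only [Finset.sum_const, Finset.card_univ, Fintype.card_fin, nsmul_eq_mul, mul_one] at hsum
  nlinarith [mul_nonneg (hc0 l) (sub_nonneg.mpr hw)]

/-- By Parseval in `W` and Pythagoras, the left side is the squared distance from `x` to `W`. -/
theorem norm_sq_sub_sum_inner_le {F : Type*} [NormedAddCommGroup F] [InnerProductSpace ℂ F]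
    (W : Submodule ℂ F) [FiniteDimensional ℂ W] {ι : Type*} [Fintype ι]
    (f : OrthonormalBasis ι ℂ W) (x : F) {y : F} (hy : y ∈ W) :
    ‖x‖ ^ 2 - ∑ s, ‖inner ℂ (f s : F) x‖ ^ 2 ≤ ‖x - y‖ ^ 2 := by
  have h1 : ∑ s, ‖inner ℂ (f s : F) x‖ ^ 2 = ‖W.orthogonalProjectionOnto x‖ ^ 2 := by
    rw [← f.sum_sq_norm_inner_right]
    refine Finset.sum_congr rfl fun s _ => ?_
    rw [Submodule.inner_orthogonalProjectionOnto_eq_of_mem_left]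
  have h2 := Submodule.norm_sq_eq_add_norm_sq_projection x W
  have h3 := Submodule.norm_sq_eq_add_norm_sq_projection (x - y) W
  have h4 : Wᗮ.orthogonalProjectionOnto (x - y) = Wᗮ.orthogonalProjectionOnto x := by
    rw [map_sub, Submodule.orthogonalProjectionOnto_orthogonal_apply_eq_zero hy, sub_zero]
  rw [h4] at h3
  rw [h1]
  nlinarith [sq_nonneg ‖W.orthogonalProjectionOnto (x - y)‖]

/-- The rows of `N` lie in a subspace `W` of dimension at most `l`, so the rows of `v` are at least
as far from those of `N` as from `W`. Since the Gram matrix is diagonal, the projection onto `W`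
captures the mass `∑ c k * w k` with `w k` the squared norm of the projected basis vector; these
weights are at most `1` and sum to `dim W`, so the bathtub principle applies. -/
theorem sum_Ico_le_norm_sub_sq {a b l : ℕ} {c : ℕ → ℝ} (hc : Antitone c) (hc0 : ∀ i, 0 ≤ c i)
    {v N : Vec a b} (hv : gram v = Matrix.diagonal fun k : Fin b => (c k : ℂ)) (hN : RankLE l N) :
    ∑ k ∈ Finset.Ico l b, c k ≤ ‖v - N‖ ^ 2 := by
  obtain ⟨X, Y, hXY⟩ := hN
  let row (u : Vec a b) (i : Fin a) : EuclideanSpace ℂ (Fin b) := WithLp.toLp 2 fun j => u (i, j)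
  have hrow : ∀ u : Vec a b, ‖u‖ ^ 2 = ∑ i, ‖row u i‖ ^ 2 := by
    intro u
    simp only [EuclideanSpace.norm_sq_eq, Fintype.sum_prod_type, row]
  let W : Submodule ℂ (EuclideanSpace ℂ (Fin b)) :=
    Submodule.span ℂ (Set.range fun s : Fin l => WithLp.toLp 2 (Y s))
  have hW : Module.finrank ℂ W ≤ l := by
    simpa [W, Set.finrank] using finrank_range_le_card (R := ℂ) fun s : Fin l =>
      (WithLp.toLp 2 (Y s) : EuclideanSpace ℂ (Fin b))
  have hmem : ∀ i, row N i ∈ W := by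
    intro i
    have : row N i = ∑ s, X i s • (WithLp.toLp 2 (Y s) : EuclideanSpace ℂ (Fin b)) := by
      ext j
      simp [row, hXY, Matrix.mul_apply]
    rw [this]
    exact Submodule.sum_mem _ fun s _ =>
      Submodule.smul_mem _ _ (Submodule.subset_span ⟨s, rfl⟩)
  let f := stdOrthonormalBasis ℂ W
  let w : Fin b → ℝ := fun k => ∑ s, ‖(f s : EuclideanSpace ℂ (Fin b)) k‖ ^ 2
  have hf : Orthonormal ℂ fun s => (f s : EuclideanSpace ℂ (Fin b)) :=
    f.orthonormal.comp_linearIsometry W.subtypeₗᵢ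
  have hw1 : ∀ k, w k ≤ 1 := by
    intro k
    have := hf.sum_inner_products_le (EuclideanSpace.single k (1 : ℂ)) (s := Finset.univ)
    simpa [w, EuclideanSpace.inner_single_right] using this
  have hwsum : ∑ k, w k ≤ l := by
    rw [Finset.sum_comm]
    simp only [← EuclideanSpace.norm_sq_eq, hf.1, one_pow]
    simpa using hW
  have hinner : ∀ g : EuclideanSpace ℂ (Fin b),
      ∑ i, ‖inner ℂ g (row v i)‖ ^ 2 = ∑ k : Fin b, c k * ‖g k‖ ^ 2 := by
    intro g
    -- Contracting Bob's side with `g` leaves a one-dimensional system, whose one-by-one Gram matrix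
    -- is the sum sought.
    let G : Matrix (Fin 1) (Fin b) ℂ := Matrix.of fun _ j => star (g j)
    have hG : ∀ i j, G i j = star (g j) := fun _ _ => rfl
    have h := sum_norm_sq_column (applyB G v) 0
    rw [gram_applyB, hv] at h
    have h1 : ∀ i, applyB G v (i, 0) = inner ℂ g (row v i) := by
      intro i
      simp [applyB_apply, hG, PiLp.inner_apply, row, mul_comm]
    have h2 : (G * Matrix.diagonal (fun k : Fin b => (c k : ℂ)) * Gᴴ) 0 0 =
        ((∑ k : Fin b, c k * ‖g k‖ ^ 2 : ℝ) : ℂ) := by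
      rw [Matrix.mul_apply]
      simp only [Matrix.mul_diagonal, Matrix.conjTranspose_apply, hG, star_star]
      push_cast
      refine Finset.sum_congr rfl fun k _ => ?_
      rw [← Complex.conj_mul']
      simp only [RCLike.star_def]
      ring
    rw [h2] at h
    simp only [h1] at h
    exact_mod_cast h
  have hnorm : ‖v‖ ^ 2 = ∑ k : Fin b, c k := by
    rw [norm_sq_eq_sum]
    refine Finset.sum_congr rfl fun k _ => ?_
    have := sum_norm_sq_column v k
    rw [hv, Matrix.diagonal_apply_eq] at this
    exact_mod_cast this
  calc ∑ k ∈ Finset.Ico l b, c k ≤ ∑ k : Fin b, c k * (1 - w k) :=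
        sum_Ico_le_sum_mul hc hc0 (fun k => by positivity) hw1 hwsum
    _ = ‖v‖ ^ 2 - ∑ i, ∑ s, ‖inner ℂ (f s : EuclideanSpace ℂ (Fin b)) (row v i)‖ ^ 2 := by
        rw [Finset.sum_comm]
        simp only [hinner]
        rw [hnorm, Finset.sum_comm, ← Finset.sum_sub_distrib]
        refine Finset.sum_congr rfl fun k _ => ?_
        rw [← Finset.mul_sum]
        ring
    _ = ∑ i, (‖row v i‖ ^ 2 - ∑ s, ‖inner ℂ (f s : EuclideanSpace ℂ (Fin b)) (row v i)‖ ^ 2) := by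
        rw [hrow, Finset.sum_sub_distrib]
    _ ≤ ∑ i, ‖row v i - row N i‖ ^ 2 :=
        Finset.sum_le_sum fun i _ => norm_sq_sub_sum_inner_le W f _ (hmem i)
    _ = ‖v - N‖ ^ 2 := by
        rw [hrow]
        rfl

/-- **Eckart–Young**, lower bound. -/
theorem schmidtTail_le_norm_sub_sq {a b l : ℕ} (Ψ : PureState a b) {N : Vec a b}
    (hN : RankLE l N) : schmidtTail b Ψ l ≤ ‖Ψ.1 - N‖ ^ 2 := by
  obtain ⟨U, hU, hg⟩ := exists_schmidt_unitary Ψ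
  rw [← norm_applyB_of_isometry hU, applyB_sub]
  exact sum_Ico_le_norm_sub_sq (schmidtCoeff_antitone Ψ) (schmidtCoeff_nonneg Ψ) hg (hN.applyB U)

/-- **Eckart–Young**, attainment. -/
theorem exists_rankLE_norm_sub_sq {a b : ℕ} (Ψ : PureState a b) (l : ℕ) :
    ∃ N : Vec a b, RankLE l N ∧ ‖Ψ.1 - N‖ ^ 2 = schmidtTail b Ψ l := by
  obtain ⟨U, hU, -, hcol⟩ := exists_schmidt_columns Ψ
  have hU' : U * Uᴴ = 1 := mul_eq_one_comm.mp hU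
  let v := applyB U Ψ.1
  -- The best approximation keeps the first `l` columns in the Schmidt basis; the discarded columns
  -- have squared norms `schmidtCoeff Ψ k`.
  let N : Vec a b := WithLp.toLp 2 fun p => if (p.2 : ℕ) < l then v p else 0
  have hN : RankLE l N := by
    refine ⟨Matrix.of fun i s => if h : (s : ℕ) < b then v (i, ⟨s, h⟩) else 0,
      Matrix.of fun s k => if (s : ℕ) = k then 1 else 0, fun i j => ?_⟩
    simp only [N, Matrix.mul_apply, Matrix.of_apply, mul_ite, mul_one, mul_zero]
    split_ifs with h
    · rw [Finset.sum_eq_single ⟨j, h⟩]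
      · simp
      · intro s _ hs
        rw [if_neg]
        intro h'
        exact hs (Fin.ext h')
      · simp
    · rw [Finset.sum_eq_zero]
      intro s _
      rw [if_neg]
      intro h'
      exact h (h' ▸ s.2)
  refine ⟨applyB Uᴴ N, hN.applyB _, ?_⟩
  rw [← norm_applyB_of_isometry hU, applyB_sub, ← applyB_mul, hU', applyB_one, norm_sq_eq_sum,
    schmidtTail]
  have : ∀ k : Fin b, ∑ i, ‖(applyB U Ψ.1 - N) (i, k)‖ ^ 2 =
      if l ≤ (k : ℕ) then schmidtCoeff Ψ k else 0 := by
    intro k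
    split_ifs with h
    · rw [← hcol k]
      simp [N, not_lt.mpr h]
    · simp [N, not_le.mp h, v]
  simp only [this]
  rw [sum_Ico_eq_sum_fin]

/-! ### Monotonicity of the tail sums -/

/-- The tail sums do not increase on average under any protocol. -/
theorem sum_outcomes_schmidtTail_le {a b : ℕ} (π : Protocol a b) (l : ℕ) (v N : Vec a b)
    (hN : RankLE l N) :
    ((π.outcomes v).map fun m => m.prob * schmidtTail m.dimB m.state l).sum ≤ ‖v - N‖ ^ 2 := by
  -- A competitor `N` of rank at most `l` is carried along with `v`: Kraus operators preserve the
  -- rank bound, completeness preserves the total squared distance, and Eckart–Young applies at the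
  -- leaves.
  induction π with
  | done =>
    by_cases h : v = 0
    · simp only [Protocol.outcomes, h, ne_eq, not_true_eq_false, dif_neg, not_false_eq_true,
        List.map_nil, List.sum_nil]
      positivity
    · simp only [Protocol.outcomes, ne_eq, h, not_false_eq_true, dif_pos, List.map_cons,
        List.map_nil, List.sum_singleton]
      have hv : 0 < ‖v‖ := norm_pos_iff.mpr h
      have h1 := schmidtTail_le_norm_sub_sq (normalize v h) (hN.smul ((‖v‖⁻¹ : ℝ) : ℂ))
      rw [normalize, ← smul_sub, norm_smul, mul_pow, Complex.norm_real, norm_inv, norm_norm] at h1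
      calc _ ≤ ‖v‖ ^ 2 * (‖v‖⁻¹ ^ 2 * ‖v - N‖ ^ 2) := by gcongr; exact h1
        _ = _ := by field_simp
  | alice a' K hK next ih =>
    rw [Protocol.outcomes, sum_map_flatMap_finRange, ← sum_norm_sq_applyA K hK (v - N)]
    refine Finset.sum_le_sum fun k _ => ?_
    rw [applyA_sub]
    exact ih k _ _ (hN.applyA _)
  | bob b' K hK next ih =>
    rw [Protocol.outcomes, sum_map_flatMap_finRange, ← sum_norm_sq_applyB K hK (v - N)]
    refine Finset.sum_le_sum fun k _ => ?_
    rw [applyB_sub]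
    exact ih k _ _ (hN.applyB _)

/-! ### Diagonal vectors -/

/-- The vector `∑ᵢ √μᵢ |i i⟩`. -/
def diagVec {d : ℕ} (μ : Fin d → ℝ) : Vec d d :=
  WithLp.toLp 2 fun p => if p.1 = p.2 then ((√(μ p.1) : ℝ) : ℂ) else 0

theorem diagVec_apply {d : ℕ} (μ : Fin d → ℝ) (i j : Fin d) :
    diagVec μ (i, j) = if i = j then ((√(μ i) : ℝ) : ℂ) else 0 := rfl

theorem norm_sq_diagVec {d : ℕ} {μ : Fin d → ℝ} (h : ∀ i, 0 ≤ μ i) :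
    ‖diagVec μ‖ ^ 2 = ∑ i, μ i := by
  rw [norm_sq_eq_sum]
  refine Finset.sum_congr rfl fun j _ => ?_
  rw [Finset.sum_eq_single j]
  · simp [diagVec_apply, h j]
  · intro i _ hi
    simp [diagVec_apply, hi]
  · simp

/-- The matrix of the isometry that permutes or embeds basis vectors. -/
def basisMap {m n : ℕ} (f : Fin m → Fin n) : Matrix (Fin n) (Fin m) ℂ :=
  Matrix.of fun i k => if f k = i then 1 else 0

theorem basisMap_apply {m n : ℕ} (f : Fin m → Fin n) (i : Fin n) (k : Fin m) :
    basisMap f i k = if f k = i then 1 else 0 := rfl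

theorem basisMap_isometry {m n : ℕ} {f : Fin m → Fin n} (hf : Function.Injective f) :
    (basisMap f)ᴴ * basisMap f = 1 := by
  ext k k'
  simp [Matrix.mul_apply, basisMap_apply, Matrix.one_apply, hf.eq_iff, eq_comm]

/-- Relabelling of the basis vectors of both parties. -/
def place {m n a b : ℕ} (f : Fin m → Fin a) (g : Fin n → Fin b) (v : Vec m n) : Vec a b :=
  applyA (basisMap f) (applyB (basisMap g) v)

theorem norm_place {m n a b : ℕ} {f : Fin m → Fin a} {g : Fin n → Fin b}
    (hf : Function.Injective f) (hg : Function.Injective g) (v : Vec m n) :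
    ‖place f g v‖ = ‖v‖ := by
  rw [place, norm_applyA_of_isometry (basisMap_isometry hf),
    norm_applyB_of_isometry (basisMap_isometry hg)]

theorem place_sub {m n a b : ℕ} (f : Fin m → Fin a) (g : Fin n → Fin b) (v w : Vec m n) :
    place f g (v - w) = place f g v - place f g w := by
  rw [place, applyB_sub, applyA_sub, place, place]

theorem place_diagVec_apply {d a b : ℕ} (f : Fin d → Fin a) (g : Fin d → Fin b) (μ : Fin d → ℝ)
    (i : Fin a) (j : Fin b) : place f g (diagVec μ) (i, j) =
      ∑ k, if f k = i ∧ g k = j then ((√(μ k) : ℝ) : ℂ) else 0 := by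
  simp only [place, applyA_apply, applyB_apply, basisMap_apply, diagVec_apply]
  refine Finset.sum_congr rfl fun k _ => ?_
  rw [Finset.sum_eq_single k]
  · by_cases h1 : f k = i <;> by_cases h2 : g k = j <;> simp [h1, h2]
  · intro k' _ hk'
    simp [hk'.symm]
  · simp

theorem place_perm_diagVec {d : ℕ} (σ : Equiv.Perm (Fin d)) (μ : Fin d → ℝ) :
    place σ σ (diagVec (μ ∘ σ)) = diagVec μ := by
  ext ⟨i, j⟩
  rw [place_diagVec_apply, diagVec_apply, Finset.sum_eq_single (σ.symm i)]
  · simp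
  · intro k _ hk
    rw [if_neg]
    rintro ⟨rfl, -⟩
    simp at hk
  · simp

theorem place_castLE_diagVec {m n : ℕ} (hmn : m ≤ n) {c : ℕ → ℝ}
    (hc : ∀ i, m ≤ i → c i = 0) :
    place (Fin.castLE hmn) (Fin.castLE hmn) (diagVec fun i : Fin m => c i) =
      diagVec fun i : Fin n => c i := by
  ext ⟨i, j⟩
  rw [place_diagVec_apply, diagVec_apply]
  rcases lt_or_ge (i : ℕ) m with hi | hi
  · rw [Finset.sum_eq_single ⟨i, hi⟩]
    · simp [Fin.ext_iff]
    · intro k _ hk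
      rw [if_neg]
      rintro ⟨h, -⟩
      exact hk (Fin.ext (by simpa [Fin.ext_iff] using h))
    · simp
  · rw [Finset.sum_eq_zero]
    · simp [hc i hi]
    · intro k _
      rw [if_neg]
      rintro ⟨h, -⟩
      have := k.2
      simp only [Fin.ext_iff, Fin.val_castLE] at h
      omega

theorem place_diagVec_one {n : ℕ} (i : Fin n) :
    place (fun _ : Fin 1 => i) (fun _ : Fin 1 => i) (diagVec fun _ => 1) =
      diagVec (Pi.single i 1) := by
  ext ⟨j, k⟩
  rw [place_diagVec_apply, diagVec_apply]
  by_cases hj : i = j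
  · subst hj
    simp
  · simp [hj, Ne.symm hj]

namespace IsMonotone

variable {E : Quantifier}

theorem hat_place (hE : IsMonotone E) {m n a b : ℕ} {f : Fin m → Fin a} {g : Fin n → Fin b}
    (hf : Function.Injective f) (hg : Function.Injective g) (v : Vec m n) :
    hat E (place f g v) = hat E v := by
  have h1 := basisMap_isometry hf
  have h2 := basisMap_isometry hg
  rw [place, hE.hat_applyA (partialIsometry_of_isometry h1) (norm_applyA_of_isometry h1 _),
    hE.hat_applyB (partialIsometry_of_isometry h2) (norm_applyB_of_isometry h2 _)]

theorem hat_diagVec_comp_perm (hE : IsMonotone E) {d : ℕ} (μ : Fin d → ℝ)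
    (σ : Equiv.Perm (Fin d)) : hat E (diagVec (μ ∘ σ)) = hat E (diagVec μ) := by
  rw [← place_perm_diagVec σ μ, hE.hat_place σ.injective σ.injective]

theorem hat_diagVec_single (hE : IsMonotone E) {n : ℕ} (i : Fin n) :
    hat E (diagVec (Pi.single i 1)) = hat E (diagVec fun _ : Fin 1 => 1) := by
  rw [← place_diagVec_one, hE.hat_place (Function.injective_of_subsingleton _)
    (Function.injective_of_subsingleton _)]

/-- Padding by zeros is a local isometry; both sides embed the diagonal vector of length `min m n`.
-/
theorem hat_diagVec_resize (hE : IsMonotone E) {m n : ℕ} {c : ℕ → ℝ}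
    (hm : ∀ i, m ≤ i → c i = 0) (hn : ∀ i, n ≤ i → c i = 0) :
    hat E (diagVec fun i : Fin m => c i) = hat E (diagVec fun i : Fin n => c i) := by
  have hmin : ∀ i, min m n ≤ i → c i = 0 := fun i hi =>
    (min_le_iff.mp hi).elim (hm i) (hn i)
  rw [← place_castLE_diagVec (min_le_left m n) hmin, ← place_castLE_diagVec (min_le_right m n) hmin,
    hE.hat_place (Fin.castLE_injective _) (Fin.castLE_injective _),
    hE.hat_place (Fin.castLE_injective _) (Fin.castLE_injective _)]

end IsMonotone

/-! ### The Schmidt decomposition -/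

/-- **Schmidt decomposition**: local partial isometries bring a pure state to diagonal form. -/
theorem exists_schmidt_decomposition {a b : ℕ} (Ψ : PureState a b) :
    ∃ (U : Matrix (Fin b) (Fin b) ℂ) (W : Matrix (Fin b) (Fin a) ℂ), Uᴴ * U = 1 ∧
      W * Wᴴ * W = W ∧
      applyA W (applyB U Ψ.1) = diagVec fun i : Fin b => schmidtCoeff Ψ i := by
  obtain ⟨U, hU, hg, -⟩ := exists_schmidt_columns Ψ
  set v := applyB U Ψ.1 with hv
  -- The rows are the conjugated columns of `v`, normalised. The inverse of `0` is `0`, so rows with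
  -- vanishing coefficient are zero and `W` is only a partial isometry.
  let W : Matrix (Fin b) (Fin a) ℂ :=
    Matrix.of fun k i => star (v (i, k)) * ((√(schmidtCoeff Ψ k))⁻¹ : ℝ)
  have hW : ∀ k i, W k i = star (v (i, k)) * ((√(schmidtCoeff Ψ k))⁻¹ : ℝ) := fun _ _ => rfl
  have hgram : ∀ k k', ∑ i, v (i, k) * star (v (i, k')) =
      if k = k' then (schmidtCoeff Ψ k : ℂ) else 0 := by
    intro k k'
    rw [← gram_apply, hg, Matrix.diagonal_apply]
  have hWW : W * Wᴴ = Matrix.diagonal fun k : Fin b =>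
      if schmidtCoeff Ψ k = 0 then 0 else 1 := by
    ext k k'
    have : (W * Wᴴ) k k' = (∑ i, v (i, k') * star (v (i, k))) *
        (((√(schmidtCoeff Ψ k))⁻¹ * (√(schmidtCoeff Ψ k'))⁻¹ : ℝ) : ℂ) := by
      rw [Matrix.mul_apply, Finset.sum_mul]
      refine Finset.sum_congr rfl fun i _ => ?_
      simp only [Matrix.conjTranspose_apply, hW, star_mul', star_star]
      simp only [RCLike.star_def, Complex.conj_ofReal]
      push_cast
      ring
    rw [this, hgram, Matrix.diagonal_apply]
    by_cases hk : k = k'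
    · subst hk
      by_cases h0 : schmidtCoeff Ψ k = 0
      · simp [h0]
      · simp only [if_true, h0, if_false]
        rw [← mul_inv, Real.mul_self_sqrt (schmidtCoeff_nonneg Ψ k), ← Complex.ofReal_mul,
          mul_inv_cancel₀ h0, Complex.ofReal_one]
    · simp [hk, Ne.symm hk]
  refine ⟨U, W, hU, ?_, ?_⟩
  · rw [hWW]
    ext k i
    rw [Matrix.diagonal_mul]
    by_cases h0 : schmidtCoeff Ψ k = 0
    · simp [h0, hW]
    · simp [h0]
  · ext ⟨k, k'⟩
    have : applyA W v (k, k') = (∑ i, v (i, k') * star (v (i, k))) *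
        (((√(schmidtCoeff Ψ k))⁻¹ : ℝ) : ℂ) := by
      rw [applyA_apply, Finset.sum_mul]
      refine Finset.sum_congr rfl fun i _ => ?_
      rw [hW]
      ring
    rw [this, hgram, diagVec_apply]
    by_cases hk : k = k'
    · subst hk
      simp only [if_true]
      rw [← Complex.ofReal_mul, ← div_eq_mul_inv, Real.div_sqrt]
    · simp [hk, Ne.symm hk]

theorem sum_fin_schmidtCoeff {a b d : ℕ} (Ψ : PureState a b) (hd : schmidtRank Ψ ≤ d) :
    ∑ i : Fin d, schmidtCoeff Ψ i = 1 := by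
  rw [← sum_schmidtCoeff Ψ, ← Finset.sum_range]
  have h : ∀ m, schmidtRank Ψ ≤ m → ∑ i ∈ Finset.range m, schmidtCoeff Ψ i =
      ∑ i ∈ Finset.range (schmidtRank Ψ), schmidtCoeff Ψ i := by
    intro m hm
    refine (Finset.sum_subset (by simpa using hm) fun i _ hi => ?_).symm
    exact (schmidtCoeff_eq_zero_iff Ψ i).mpr (by simpa using hi)
  rw [h d hd, h b (schmidtRank_le_right Ψ)]

/-- The partial isometries of the Schmidt decomposition preserve the norm of `Ψ`, so they preserve
`E`. This turns the monotone into a function of the Schmidt vector. -/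
theorem IsMonotone.eq_hat_diagVec {E : Quantifier} (hE : IsMonotone E) {a b d : ℕ}
    (Ψ : PureState a b) (hd : schmidtRank Ψ ≤ d) :
    E a b Ψ = hat E (diagVec fun i : Fin d => schmidtCoeff Ψ i) := by
  obtain ⟨U, W, hU, hW, h⟩ := exists_schmidt_decomposition Ψ
  have hn : ‖applyB U Ψ.1‖ = ‖Ψ.1‖ := norm_applyB_of_isometry hU _
  have hn' : ‖applyA W (applyB U Ψ.1)‖ = ‖applyB U Ψ.1‖ := by
    rw [← sq_eq_sq₀ (norm_nonneg _) (norm_nonneg _), hn, Ψ.norm_eq, h,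
      norm_sq_diagVec fun i => schmidtCoeff_nonneg Ψ i,
      sum_fin_schmidtCoeff Ψ (schmidtRank_le_right Ψ), one_pow]
  rw [← hat_coe E Ψ, ← hE.hat_applyB (partialIsometry_of_isometry hU) hn, ← hE.hat_applyA hW hn', h]
  exact hE.hat_diagVec_resize (fun i hi => schmidtCoeff_eq_zero_of_le Ψ hi)
    fun i hi => (schmidtCoeff_eq_zero_iff Ψ i).mpr (hd.trans hi)

/-! ### Diagonal measurements -/

/-- The Kraus operators of a measurement that takes `∑ᵢ √λᵢ |i i⟩` to the ensemble of the
`∑ᵢ √νⱼᵢ |i i⟩` with probabilities `pⱼ`, where `λ = ∑ⱼ pⱼ νⱼ`. -/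
def ensembleKraus {d n : ℕ} (c : Fin d → ℝ) (p : Fin n → ℝ) (ν : Fin n → Fin d → ℝ) (k : Fin n) :
    Matrix (Fin d) (Fin d) ℂ :=
  -- Where `c i = 0` the entry does not affect the image of `diagVec c`; the value `√(p k)` is
  -- chosen for completeness.
  Matrix.diagonal fun i => ((if c i = 0 then √(p k) else √(p k * ν k i / c i) : ℝ) : ℂ)

section Ensemble

variable {d n : ℕ} {c : Fin d → ℝ} {p : Fin n → ℝ} {ν : Fin n → Fin d → ℝ}

theorem ensembleKraus_complete (hp : ∀ k, 0 ≤ p k) (hp1 : ∑ k, p k = 1) (hν : ∀ k i, 0 ≤ ν k i)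
    (hc : ∀ i, c i = ∑ k, p k * ν k i) :
    ∑ k, (ensembleKraus c p ν k)ᴴ * ensembleKraus c p ν k = 1 := by
  have hc0 : ∀ i, 0 ≤ c i := fun i => hc i ▸
    Finset.sum_nonneg fun k _ => mul_nonneg (hp k) (hν k i)
  simp only [ensembleKraus, Matrix.diagonal_conjTranspose, Matrix.diagonal_mul_diagonal]
  ext i j
  rw [Matrix.sum_apply]
  by_cases hij : i = j
  · subst hij
    simp only [Matrix.diagonal_apply_eq, Matrix.one_apply_eq, Pi.star_apply, RCLike.star_def,
      Complex.conj_ofReal, ← Complex.ofReal_mul, ← Complex.ofReal_sum]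
    rw [← Complex.ofReal_one]
    congr 1
    split_ifs with h
    · simpa [hp] using hp1
    · have : ∀ k, √(p k * ν k i / c i) * √(p k * ν k i / c i) = p k * ν k i / c i := fun k =>
        Real.mul_self_sqrt (div_nonneg (mul_nonneg (hp k) (hν k i)) (hc0 i))
      simp only [this]
      rw [← Finset.sum_div, ← hc, div_self h]
  · simp [hij]

theorem applyA_ensembleKraus (hp : ∀ k, 0 ≤ p k) (hν : ∀ k i, 0 ≤ ν k i)
    (hc : ∀ i, c i = ∑ k, p k * ν k i) (k : Fin n) :
    applyA (ensembleKraus c p ν k) (diagVec c) = ((√(p k) : ℝ) : ℂ) • diagVec (ν k) := by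
  have hc0 : ∀ i, 0 ≤ c i := fun i => hc i ▸
    Finset.sum_nonneg fun k _ => mul_nonneg (hp k) (hν k i)
  ext ⟨i, j⟩
  rw [applyA_apply, Finset.sum_eq_single i]
  · simp only [ensembleKraus, Matrix.diagonal_apply_eq, diagVec_apply, PiLp.smul_apply, smul_eq_mul,
      mul_ite, mul_zero]
    by_cases hij : i = j
    · simp only [hij, if_true, ← Complex.ofReal_mul]
      congr 1
      split_ifs with h
      · rw [h, Real.sqrt_zero, mul_zero, ← Real.sqrt_mul (hp k)]
        have h0 := (Finset.sum_eq_zero_iff_of_nonneg fun k _ =>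
          mul_nonneg (hp k) (hν k j)).mp ((hc j).symm.trans h) k (Finset.mem_univ k)
        rw [h0, Real.sqrt_zero]
      · rw [← Real.sqrt_mul (div_nonneg (mul_nonneg (hp k) (hν k j)) (hc0 j)),
          div_mul_cancel₀ _ h, Real.sqrt_mul (hp k)]
    · simp [hij]
  · intro i' _ hi'
    simp [ensembleKraus, Ne.symm hi']
  · simp

/-- Alice alone can measure the mixture into its components, so monotonicity becomes concavity in
the Schmidt vector. -/
theorem IsMonotone.sum_mul_hat_diagVec_le {E : Quantifier} (hE : IsMonotone E)
    (hp : ∀ k, 0 ≤ p k) (hp1 : ∑ k, p k = 1) (hν : ∀ k i, 0 ≤ ν k i)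
    (hc : ∀ i, c i = ∑ k, p k * ν k i) :
    ∑ k, p k * hat E (diagVec (ν k)) ≤ hat E (diagVec c) := by
  have h := hE.sum_hat_applyA_le _ (ensembleKraus_complete hp hp1 hν hc) (diagVec c)
  simp only [applyA_ensembleKraus hp hν hc, hat_smul E (Real.sqrt_nonneg _),
    Real.sq_sqrt (hp _)] at h
  exact h

end Ensemble

/-- A monotone is minimal on product states. -/
theorem IsMonotone.hat_product_le {E : Quantifier} (hE : IsMonotone E) {a b : ℕ}
    (Φ : PureState a b) : hat E (diagVec fun _ : Fin 1 => 1) ≤ E a b Φ := by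
  have hb := schmidtRank_le_right Φ
  have h := hE.sum_mul_hat_diagVec_le (c := fun i : Fin b => schmidtCoeff Φ i)
    (p := fun i : Fin b => schmidtCoeff Φ i) (ν := fun k => Pi.single k 1)
    (fun k => schmidtCoeff_nonneg Φ k) (sum_fin_schmidtCoeff Φ hb)
    (fun k i => by by_cases h : i = k <;> simp [h]) (fun i => by
      simp [Pi.single_apply])
  simp only [hE.hat_diagVec_single] at h
  rwa [← Finset.sum_mul, sum_fin_schmidtCoeff Φ hb, one_mul, ← hE.eq_hat_diagVec Φ hb] at h

/-! ### Success probabilities -/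

open Classical in
/-- The accumulated success probability of a protocol run on an unnormalised vector. -/
def success (E : Quantifier) (t : ℝ) {a b : ℕ} (π : Protocol a b) (v : Vec a b) : ℝ :=
  (((π.outcomes v).filter fun m => t ≤ E m.dimA m.dimB m.state).map fun m => m.prob).sum

theorem prob_pos_of_mem_outcomes {a b : ℕ} (π : Protocol a b) (v : Vec a b) :
    ∀ m ∈ π.outcomes v, 0 < m.prob := by
  induction π with
  | done =>
    by_cases h : v = 0
    · simp [Protocol.outcomes, h]
    · simp [Protocol.outcomes, h]
  | alice a' K hK next ih =>
    intro m hm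
    simp only [Protocol.outcomes, List.mem_flatMap] at hm
    obtain ⟨k, -, hk⟩ := hm
    exact ih k _ m hk
  | bob b' K hK next ih =>
    intro m hm
    simp only [Protocol.outcomes, List.mem_flatMap] at hm
    obtain ⟨k, -, hk⟩ := hm
    exact ih k _ m hk

section Success

variable {E : Quantifier} {t : ℝ} {a b : ℕ}

theorem success_nonneg (π : Protocol a b) (v : Vec a b) : 0 ≤ success E t π v := by
  refine List.sum_nonneg fun x hx => ?_
  obtain ⟨m, hm, rfl⟩ := List.mem_map.mp hx
  exact (prob_pos_of_mem_outcomes π v m (List.mem_of_mem_filter hm)).le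

theorem success_alice {n : ℕ} (a' : Fin n → ℕ) (K : (k : Fin n) → Matrix (Fin (a' k)) (Fin a) ℂ)
    (hK : ∑ k, (K k)ᴴ * K k = 1) (next : (k : Fin n) → Protocol (a' k) b) (v : Vec a b) :
    success E t (.alice a' K hK next) v = ∑ k, success E t (next k) (applyA (K k) v) := by
  rw [success, Protocol.outcomes, List.filter_flatMap, sum_map_flatMap_finRange]
  rfl

theorem success_bob {n : ℕ} (b' : Fin n → ℕ) (K : (k : Fin n) → Matrix (Fin (b' k)) (Fin b) ℂ)
    (hK : ∑ k, (K k)ᴴ * K k = 1) (next : (k : Fin n) → Protocol a (b' k)) (v : Vec a b) :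
    success E t (.bob b' K hK next) v = ∑ k, success E t (next k) (applyB (K k) v) := by
  rw [success, Protocol.outcomes, List.filter_flatMap, sum_map_flatMap_finRange]
  rfl

/-- The dichotomy of `K` is performed first: its outcome `0` continues with `π`, and the other
outcome stops and can only add to the success probability. -/
theorem exists_success_of_applyA {a' : ℕ} {K : Matrix (Fin a') (Fin a) ℂ} (hK : K * Kᴴ * K = K)
    (v : Vec a b) (π : Protocol a' b) :
    ∃ π' : Protocol a b, success E t π (applyA K v) ≤ success E t π' v := by
  let next : (k : Fin 2) → Protocol (![a', a] k) b
    | 0 => π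
    | 1 => .done
  refine ⟨.alice _ _ (dichotomy_complete hK) next, ?_⟩
  rw [success_alice, Fin.sum_univ_two]
  exact le_add_of_nonneg_right (success_nonneg _ _)

theorem exists_success_of_applyB {b' : ℕ} {K : Matrix (Fin b') (Fin b) ℂ} (hK : K * Kᴴ * K = K)
    (v : Vec a b) (π : Protocol a b') :
    ∃ π' : Protocol a b, success E t π (applyB K v) ≤ success E t π' v := by
  let next : (k : Fin 2) → Protocol a (![b', b] k)
    | 0 => π
    | 1 => .done
  refine ⟨.bob _ _ (dichotomy_complete hK) next, ?_⟩
  rw [success_bob, Fin.sum_univ_two]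
  exact le_add_of_nonneg_right (success_nonneg _ _)

theorem le_success_done {p : ℝ} (hp : 0 ≤ p) {v : Vec a b} (hv : ‖v‖ = 1) (ht : t ≤ hat E v) :
    p ≤ success E t .done (((√p : ℝ) : ℂ) • v) := by
  rcases hp.eq_or_lt with rfl | hp
  · exact success_nonneg _ _
  have hs : 0 < √p := Real.sqrt_pos.mpr hp
  have h : v ≠ 0 := by
    rintro rfl
    simp at hv
  have h' : ((√p : ℝ) : ℂ) • v ≠ 0 := smul_ne_zero (by exact_mod_cast hs.ne') h
  have hE : t ≤ E a b (normalize _ h') := by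
    rw [normalize_smul hs v h h']
    simpa [hat, h, hv] using ht
  simp only [success, Protocol.outcomes, h', ne_eq, not_false_eq_true, dif_pos]
  rw [List.filter_cons_of_pos (by simpa using hE)]
  simp [norm_smul, hv, hp.le]

/-- If a Schmidt vector is a mixture, one measurement reaches the good part of the mixture. -/
theorem exists_success_diagVec {ι κ : Type*} [Fintype ι] [Fintype κ] {d : ℕ} {c : Fin d → ℝ}
    {p : ι ⊕ κ → ℝ} {ν : ι ⊕ κ → Fin d → ℝ} (hp : ∀ k, 0 ≤ p k) (hp1 : ∑ k, p k = 1)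
    (hν : ∀ k, ν k ∈ stdSimplex ℝ (Fin d)) (hc : ∀ i, c i = ∑ k, p k * ν k i)
    (ht : ∀ k, t ≤ hat E (diagVec (ν (.inl k)))) :
    ∃ π : Protocol d d, ∑ k, p (.inl k) ≤ success E t π (diagVec c) := by
  let e := (Fintype.equivFin (ι ⊕ κ)).symm
  have hp' : ∀ k, 0 ≤ (p ∘ e) k := fun k => hp _
  have hν' : ∀ k i, 0 ≤ (ν ∘ e) k i := fun k i => (hν _).1 i
  have hc' : ∀ i, c i = ∑ k, (p ∘ e) k * (ν ∘ e) k i := fun i => by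
    rw [hc i]
    exact (e.sum_comp fun k => p k * ν k i).symm
  refine ⟨.alice _ _ (ensembleKraus_complete hp' ((e.sum_comp p).trans hp1) hν' hc')
    fun _ => .done, ?_⟩
  rw [success_alice]
  simp only [applyA_ensembleKraus hp' hν' hc']
  have h := e.sum_comp fun k => success E t .done (((√(p k) : ℝ) : ℂ) • diagVec (ν k))
  refine le_trans ?_ h.ge
  rw [Fintype.sum_sum_type]
  refine le_add_of_le_of_nonneg (Finset.sum_le_sum fun k _ => ?_)
    (Finset.sum_nonneg fun k _ => success_nonneg _ _)
  refine le_success_done (hp _) ?_ (ht k)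
  rw [← sq_eq_sq₀ (norm_nonneg _) zero_le_one, norm_sq_diagVec (hν _).1, (hν _).2, one_pow]

end Success

/-! ### Majorization -/

/-- The sum of the entries from index `l` on. -/
def tail {d : ℕ} (l : ℕ) (μ : Fin d → ℝ) : ℝ := ∑ i : Fin d, if l ≤ (i : ℕ) then μ i else 0

@[simp] theorem tail_zero {d : ℕ} (μ : Fin d → ℝ) : tail 0 μ = ∑ i, μ i := by simp [tail]

theorem tail_nonneg {d : ℕ} {μ : Fin d → ℝ} (h : ∀ i, 0 ≤ μ i) (l : ℕ) : 0 ≤ tail l μ :=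
  Finset.sum_nonneg fun i _ => by split_ifs <;> simp [h i]

theorem tail_add {d : ℕ} (l : ℕ) (μ ν : Fin d → ℝ) : tail l (μ + ν) = tail l μ + tail l ν := by
  simp only [tail, ← Finset.sum_add_distrib]
  refine Finset.sum_congr rfl fun i _ => ?_
  split_ifs <;> simp

theorem tail_smul {d : ℕ} (l : ℕ) (r : ℝ) (μ : Fin d → ℝ) : tail l (r • μ) = r * tail l μ := by
  simp only [tail, Finset.mul_sum]
  refine Finset.sum_congr rfl fun i _ => ?_
  split_ifs <;> simp

theorem tail_sub {d : ℕ} (l : ℕ) (μ ν : Fin d → ℝ) : tail l (μ - ν) = tail l μ - tail l ν := by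
  simp only [tail, ← Finset.sum_sub_distrib]
  refine Finset.sum_congr rfl fun i _ => ?_
  split_ifs <;> simp

theorem continuous_tail {d : ℕ} (l : ℕ) : Continuous (tail l : (Fin d → ℝ) → ℝ) := by
  unfold tail
  refine continuous_finsetSum _ fun i _ => ?_
  split_ifs <;> fun_prop

theorem tail_single_zero {d : ℕ} (hd : 0 < d) {l : ℕ} (hl : l ≠ 0) :
    tail l (Pi.single ⟨0, hd⟩ 1 : Fin d → ℝ) = 0 := by
  refine Finset.sum_eq_zero fun i _ => ?_
  split_ifs with h
  · rw [Pi.single_eq_of_ne]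
    rintro rfl
    simp_all
  · rfl

theorem antitone_single_zero {d : ℕ} (hd : 0 < d) :
    Antitone (Pi.single ⟨0, hd⟩ 1 : Fin d → ℝ) := by
  intro i j hij
  by_cases hj : j = ⟨0, hd⟩
  · have hi : i = ⟨0, hd⟩ := by
      subst hj
      exact Fin.ext (by simpa [Fin.le_def] using hij)
    rw [hi, hj]
  · rw [Pi.single_eq_of_ne hj]
    simp only [Pi.single_apply]
    split_ifs <;> simp

/-- Abel summation, peeling off the first entry. The free bound `c` lets the induction hypothesis
for the remaining entries be used with `c = g 0`. -/
theorem sum_mul_le_of_tail_nonneg {d : ℕ} {g x : Fin d → ℝ} (hg : Antitone g)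
    (hx : ∀ l, 0 ≤ tail l x) {c : ℝ} (hc : ∀ i, g i ≤ c) : ∑ i, g i * x i ≤ c * ∑ i, x i := by
  induction d generalizing c with
  | zero => simp
  | succ d ih =>
    have hsucc : ∀ l, tail (l + 1) x = tail l fun i => x i.succ := by
      intro l
      simp [tail, Fin.sum_univ_succ]
    have h := ih (g := fun i => g i.succ) (x := fun i => x i.succ)
      (fun i j hij => hg (Fin.succ_le_succ_iff.mpr hij)) (fun l => hsucc l ▸ hx (l + 1))
      (c := g 0) (fun i => hg (Fin.zero_le _))
    have h0 := hx 0
    rw [tail_zero] at h0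
    calc ∑ i, g i * x i ≤ g 0 * x 0 + g 0 * ∑ i : Fin d, x i.succ := by
          rw [Fin.sum_univ_succ]
          gcongr
      _ = g 0 * ∑ i, x i := by
          rw [Fin.sum_univ_succ, mul_add]
      _ ≤ c * ∑ i, x i := mul_le_mul_of_nonneg_right (hc 0) h0

/-- **Rado's theorem**: a vector lies in the convex hull of the rearrangements of any vector that
majorizes it. -/
theorem mem_convexHull_perm_of_tail_le {d : ℕ} {c γ : Fin d → ℝ} (hc : Antitone c)
    (hsum : ∑ i, c i = ∑ i, γ i) (htail : ∀ l, tail l γ ≤ tail l c) :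
    c ∈ convexHull ℝ (Set.range fun σ : Equiv.Perm (Fin d) => γ ∘ σ) := by
  by_contra hmem
  -- A functional separates `c` strictly from the hull. Sorting its coefficients in descending order
  -- does not lower its value at `c` (rearrangement inequality), and passing from `c` to `γ` does
  -- not lower it either (Abel summation); the result is the value of `f` at a rearrangement of `γ`,
  -- a contradiction.
  obtain ⟨f, u, hfu, hux⟩ := geometric_hahn_banach_closed_point (convex_convexHull ℝ _)
    ((Set.finite_range _).isClosed_convexHull ℝ) hmem
  let g : Fin d → ℝ := fun i => f (Pi.single i 1)
  have hf : ∀ x, f x = ∑ i, g i * x i := by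
    intro x
    conv_lhs => rw [pi_eq_sum_univ' x]
    simp [g, mul_comm]
  let τ : Equiv.Perm (Fin d) := Tuple.sort fun i => -g i
  have hτ : Antitone (g ∘ τ) := by
    intro i j hij
    have := Tuple.monotone_sort (fun i => -g i) hij
    simpa using this
  have h1 : ∑ i, g i * c i ≤ ∑ i, g (τ i) * c i := by
    have := (hτ.monovary hc).sum_comp_perm_mul_le_sum_mul (σ := τ.symm)
    simpa using this
  have h2 : ∑ i, g (τ i) * c i ≤ ∑ i, g (τ i) * γ i := by
    rcases Nat.eq_zero_or_pos d with rfl | hd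
    · simp
    have := sum_mul_le_of_tail_nonneg hτ (x := c - γ)
      (fun l => by rw [tail_sub]; linarith [htail l]) (c := g (τ ⟨0, hd⟩))
      (fun i => hτ (Fin.le_def.mpr (Nat.zero_le _)))
    simp only [Pi.sub_apply, mul_sub, Finset.sum_sub_distrib, hsum, sub_self, mul_zero,
      Function.comp_apply] at this
    linarith
  have h3 : f (γ ∘ τ.symm) = ∑ i, g (τ i) * γ i := by
    rw [hf, ← Equiv.sum_comp τ]
    simp
  have h4 := hfu _ (subset_convexHull ℝ _ ⟨τ.symm, rfl⟩)
  rw [h3] at h4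
  rw [hf] at hux
  linarith

/-! ### States with a prescribed Schmidt vector -/

theorem schmidtTail_eq_tail {a b : ℕ} (d : ℕ) (Ψ : PureState a b) (l : ℕ) :
    schmidtTail d Ψ l = tail l fun i : Fin d => schmidtCoeff Ψ i :=
  sum_Ico_eq_sum_fin l d _

theorem schmidtTail_nonneg {a b : ℕ} (d : ℕ) (Ψ : PureState a b) (l : ℕ) :
    0 ≤ schmidtTail d Ψ l :=
  Finset.sum_nonneg fun i _ => schmidtCoeff_nonneg Ψ i

theorem schmidtTail_eq_of_rank_le {a b d e : ℕ} (Ψ : PureState a b) (hd : schmidtRank Ψ ≤ d)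
    (he : schmidtRank Ψ ≤ e) (l : ℕ) : schmidtTail d Ψ l = schmidtTail e Ψ l := by
  have h : ∀ m, schmidtRank Ψ ≤ m → schmidtTail m Ψ l = schmidtTail (schmidtRank Ψ) Ψ l := by
    intro m hm
    refine (Finset.sum_subset (Finset.Ico_subset_Ico_right hm) fun i hi hi' => ?_).symm
    refine (schmidtCoeff_eq_zero_iff Ψ i).mpr ?_
    simp only [Finset.mem_Ico, not_and, not_lt] at hi hi'
    exact hi' hi.1
  rw [h d hd, h e he]

theorem schmidtTail_rank {a b : ℕ} (Ψ : PureState a b) (l : ℕ) :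
    schmidtTail b Ψ l = schmidtTail (schmidtRank Ψ) Ψ l :=
  schmidtTail_eq_of_rank_le Ψ (schmidtRank_le_right Ψ) le_rfl l

theorem schmidtTail_zero {a b d : ℕ} (Ψ : PureState a b) (hd : schmidtRank Ψ ≤ d) :
    schmidtTail d Ψ 0 = 1 := by
  rw [schmidtTail_eq_tail, tail_zero, sum_fin_schmidtCoeff Ψ hd]

theorem schmidtRank_pos {a b : ℕ} (Ψ : PureState a b) : 0 < schmidtRank Ψ := by
  by_contra h
  have := schmidtTail_zero Ψ (d := 0) (by omega)
  simp [schmidtTail] at this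

theorem schmidtRank_le_of_schmidtTail_nonpos {a b d : ℕ} (Ψ : PureState a b)
    (h : schmidtTail b Ψ d ≤ 0) : schmidtRank Ψ ≤ d := by
  rcases lt_or_ge d b with hd | hd
  · rw [← schmidtCoeff_eq_zero_iff]
    refine le_antisymm (le_trans ?_ h) (schmidtCoeff_nonneg Ψ d)
    exact Finset.single_le_sum (f := schmidtCoeff Ψ) (fun i _ => schmidtCoeff_nonneg Ψ i)
      (Finset.mem_Ico.mpr ⟨le_rfl, hd⟩)
  · exact (schmidtRank_le_right Ψ).trans hd

/-- The Schmidt vector as a point of the simplex. -/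
def schmidtVec {a b d : ℕ} (Ψ : PureState a b) (hd : schmidtRank Ψ ≤ d) : stdSimplex ℝ (Fin d) :=
  ⟨fun i => schmidtCoeff Ψ i, fun i => schmidtCoeff_nonneg Ψ i, sum_fin_schmidtCoeff Ψ hd⟩

theorem antitone_schmidtVec {a b d : ℕ} (Ψ : PureState a b) (hd : schmidtRank Ψ ≤ d) :
    Antitone (schmidtVec Ψ hd).1 := fun _ _ hij => schmidtCoeff_antitone Ψ hij

theorem tail_schmidtVec {a b d : ℕ} (Ψ : PureState a b) (hd : schmidtRank Ψ ≤ d) (l : ℕ) :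
    tail l (schmidtVec Ψ hd).1 = schmidtTail d Ψ l := (schmidtTail_eq_tail d Ψ l).symm

theorem norm_diagVec_of_mem {d : ℕ} {μ : Fin d → ℝ} (hμ : μ ∈ stdSimplex ℝ (Fin d)) :
    ‖diagVec μ‖ = 1 := by
  rw [← sq_eq_sq₀ (norm_nonneg _) zero_le_one, norm_sq_diagVec hμ.1, hμ.2, one_pow]

theorem continuous_applyA {a a' b : ℕ} (K : Matrix (Fin a') (Fin a) ℂ) :
    Continuous (applyA K : Vec a b → Vec a' b) :=
  LinearMap.continuous_of_finiteDimensional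
    (Matrix.toEuclideanLin (K ⊗ₖ (1 : Matrix (Fin b) (Fin b) ℂ)))

theorem continuous_applyB {a b b' : ℕ} (K : Matrix (Fin b') (Fin b) ℂ) :
    Continuous (applyB K : Vec a b → Vec a b') :=
  LinearMap.continuous_of_finiteDimensional
    (Matrix.toEuclideanLin ((1 : Matrix (Fin a) (Fin a) ℂ) ⊗ₖ K))

section StateOf

variable {a b d : ℕ} (ha : d ≤ a) (hb : d ≤ b)

/-- The state `∑ᵢ √μᵢ |i i⟩` in `ℂᵃ ⊗ ℂᵇ`. -/
def stateOf (μ : stdSimplex ℝ (Fin d)) : PureState a b :=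
  ⟨place (Fin.castLE ha) (Fin.castLE hb) (diagVec μ.1), by
    rw [mem_sphere_zero_iff_norm, norm_place (Fin.castLE_injective _) (Fin.castLE_injective _),
      norm_diagVec_of_mem μ.2]⟩

theorem IsMonotone.eq_hat_stateOf {E : Quantifier} (hE : IsMonotone E)
    (μ : stdSimplex ℝ (Fin d)) : E a b (stateOf ha hb μ) = hat E (diagVec μ.1) := by
  rw [← hat_coe E (stateOf ha hb μ), stateOf, hE.hat_place (Fin.castLE_injective _) (Fin.castLE_injective _)]

theorem continuous_stateOf :
    Continuous (stateOf ha hb : stdSimplex ℝ (Fin d) → PureState a b) := by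
  refine Continuous.subtype_mk ?_ _
  have h : Continuous fun μ : stdSimplex ℝ (Fin d) => diagVec μ.1 := by
    refine (PiLp.continuous_toLp 2 _).comp (continuous_pi fun p => ?_)
    split_ifs
    · exact Complex.continuous_ofReal.comp
        (Real.continuous_sqrt.comp ((continuous_apply _).comp continuous_subtype_val))
    · exact continuous_const
  exact (continuous_applyA _).comp ((continuous_applyB _).comp h)

/-- Dropping the entries of `μ` from `l` on leaves a vector of rank at most `l` at squared distance
`tail l μ`, so Eckart–Young applies. Only an inequality holds because `μ` need not be sorted. -/
theorem schmidtTail_stateOf_le (μ : stdSimplex ℝ (Fin d)) (l : ℕ) :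
    schmidtTail b (stateOf ha hb μ) l ≤ tail l μ.1 := by
  let ν : Fin d → ℝ := fun i => if (i : ℕ) < l then μ.1 i else 0
  have hN : RankLE l (diagVec ν) := by
    refine ⟨Matrix.of fun i s => if (s : ℕ) = i then ((√(μ.1 i) : ℝ) : ℂ) else 0,
      Matrix.of fun s j => if (s : ℕ) = j then 1 else 0, fun i j => ?_⟩
    simp only [diagVec_apply, Matrix.mul_apply, Matrix.of_apply, mul_ite, mul_one, mul_zero, ν]
    by_cases hij : i = j
    · subst hij
      by_cases hi : (i : ℕ) < l
      · rw [Finset.sum_eq_single ⟨i, hi⟩]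
        · simp [hi]
        · intro s _ hs
          rw [if_neg fun h => hs (Fin.ext h)]
        · simp
      · rw [Finset.sum_eq_zero]
        · simp [hi]
        · intro s _
          rw [if_neg fun h : (s : ℕ) = i => hi (h ▸ s.2)]
    · rw [Finset.sum_eq_zero]
      · simp [hij]
      · intro s _
        by_cases h1 : (s : ℕ) = j
        · rw [if_pos h1, if_neg]
          intro h2
          exact hij (Fin.ext (h2.symm.trans h1))
        · rw [if_neg h1]
  refine (schmidtTail_le_norm_sub_sq _ ((hN.applyB (basisMap (Fin.castLE hb))).applyA
    (basisMap (Fin.castLE ha)))).trans ?_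
  change ‖place _ _ (diagVec μ.1) - place _ _ (diagVec ν)‖ ^ 2 ≤ _
  rw [← place_sub, norm_place (Fin.castLE_injective _) (Fin.castLE_injective _)]
  have hsub : diagVec μ.1 - diagVec ν = diagVec fun i => if l ≤ (i : ℕ) then μ.1 i else 0 := by
    ext ⟨i, j⟩
    simp only [PiLp.sub_apply, diagVec_apply, ν]
    by_cases hij : i = j
    · rcases lt_or_ge (i : ℕ) l with h | h
      · simp [h, not_le.mpr h]
      · simp [h, not_lt.mpr h]
    · simp [hij]
  rw [hsub, norm_sq_diagVec fun i => ?_]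
  · rfl
  · split_ifs
    · exact μ.2.1 i
    · exact le_rfl

theorem schmidtRank_stateOf_le (μ : stdSimplex ℝ (Fin d)) :
    schmidtRank (stateOf ha hb μ) ≤ d := by
  refine schmidtRank_le_of_schmidtTail_nonpos _ ((schmidtTail_stateOf_le ha hb μ d).trans_eq ?_)
  exact Finset.sum_eq_zero fun i _ => if_neg (not_le.mpr i.2)

end StateOf

/-! ### The upper bound -/

theorem sum_map_eq_sum_get {α : Type*} (L : List α) (f : α → ℝ) :
    (L.map f).sum = ∑ i : Fin L.length, f (L.get i) := by
  exact (Fin.sum_univ_fun_getElem L f).symm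

/-- The average Schmidt vector of the successful outcomes. -/
theorem exists_mean_schmidtVec {E : Quantifier} (hE : IsMonotone E) {t : ℝ} {a b : ℕ}
    (Ψ : PureState a b) (π : Protocol a b) (hp : 0 < successProb E t π Ψ) :
    ∃ μ : stdSimplex ℝ (Fin (schmidtRank Ψ)), Antitone μ.1 ∧ t ≤ hat E (diagVec μ.1) ∧
      ∀ l, successProb E t π Ψ * tail l μ.1 ≤ schmidtTail (schmidtRank Ψ) Ψ l := by
  classical
  set d := schmidtRank Ψ with hd
  set p := successProb E t π Ψ with hpdef
  let L := (π.outcomes Ψ.1).filter fun m => t ≤ E m.dimA m.dimB m.state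
  have hfull : ∀ l, ((π.outcomes Ψ.1).map fun m => m.prob * schmidtTail m.dimB m.state l).sum ≤
      schmidtTail d Ψ l := by
    intro l
    obtain ⟨N, hN, h⟩ := exists_rankLE_norm_sub_sq Ψ l
    rw [hd, ← schmidtTail_rank, ← h]
    exact sum_outcomes_schmidtTail_le π l Ψ.1 N hN
  have hnn : ∀ l, ∀ x ∈ (π.outcomes Ψ.1).map fun m => m.prob * schmidtTail m.dimB m.state l,
      0 ≤ x := by
    intro l x hx
    obtain ⟨m, hm, rfl⟩ := List.mem_map.mp hx
    exact mul_nonneg (prob_pos_of_mem_outcomes π _ m hm).le (schmidtTail_nonneg _ _ _)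
  have hmem : ∀ i : Fin L.length, L.get i ∈ π.outcomes Ψ.1 ∧
      t ≤ E (L.get i).dimA (L.get i).dimB (L.get i).state := by
    intro i
    simpa using List.mem_filter.mp (L.get_mem i)
  have hprob : ∀ i : Fin L.length, 0 < (L.get i).prob := fun i =>
    prob_pos_of_mem_outcomes π _ _ (hmem i).1
  -- The tail of `Ψ` from index `d` vanishes, hence so does that of every outcome; all the Schmidt
  -- vectors thus live in one simplex.
  have hrank : ∀ i : Fin L.length, schmidtRank (L.get i).state ≤ d := by
    intro i
    refine schmidtRank_le_of_schmidtTail_nonpos _ ?_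
    have h1 := List.single_le_sum (hnn d) _ (List.mem_map_of_mem (hmem i).1)
    have h2 : schmidtTail d Ψ d = 0 := by simp [schmidtTail]
    have h3 := h1.trans ((hfull d).trans_eq h2)
    exact nonpos_of_mul_nonpos_right h3 (hprob i)
  have hpsum : p = ∑ i, (L.get i).prob := sum_map_eq_sum_get L _
  let w : Fin L.length → ℝ := fun i => (L.get i).prob / p
  have hw0 : ∀ i, 0 ≤ w i := fun i => div_nonneg (hprob i).le hp.le
  have hw1 : ∑ i, w i = 1 := by
    rw [← Finset.sum_div, ← hpsum, div_self hp.ne']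
  let ν : Fin L.length → Fin d → ℝ := fun i => (schmidtVec (L.get i).state (hrank i)).1
  have hν : ∀ i, ν i ∈ stdSimplex ℝ (Fin d) := fun i =>
    (schmidtVec (L.get i).state (hrank i)).2
  refine ⟨⟨∑ i, w i • ν i, (convex_stdSimplex ℝ _).sum_mem (fun i _ => hw0 i) hw1
    fun i _ => hν i⟩, ?_, ?_, fun l => ?_⟩
  · intro j k hjk
    simp only [Finset.sum_apply, Pi.smul_apply, smul_eq_mul]
    exact Finset.sum_le_sum fun i _ =>
      mul_le_mul_of_nonneg_left (antitone_schmidtVec _ (hrank i) hjk) (hw0 i)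
  · calc t = ∑ i, w i * t := by rw [← Finset.sum_mul, hw1, one_mul]
      _ ≤ ∑ i, w i * hat E (diagVec (ν i)) := by
          refine Finset.sum_le_sum fun i _ => mul_le_mul_of_nonneg_left ?_ (hw0 i)
          exact (hmem i).2.trans_eq (hE.eq_hat_diagVec _ (hrank i))
      _ ≤ _ := hE.sum_mul_hat_diagVec_le hw0 hw1 (fun i => (hν i).1) fun j => by
          simp [Finset.sum_apply]
  · have htail : p * tail l (∑ i, w i • ν i) =
        (L.map fun m => m.prob * schmidtTail m.dimB m.state l).sum := by
      have h : tail l (∑ i, w i • ν i) = ∑ i, w i * tail l (ν i) := by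
        simp only [tail, Finset.sum_apply, Pi.smul_apply, smul_eq_mul, Finset.mul_sum]
        rw [Finset.sum_comm]
        refine Finset.sum_congr rfl fun j _ => ?_
        split_ifs <;> simp
      rw [h, sum_map_eq_sum_get, Finset.mul_sum]
      refine Finset.sum_congr rfl fun i _ => ?_
      rw [tail_schmidtVec, schmidtTail_eq_of_rank_le _ (hrank i) (schmidtRank_le_right _),
        ← mul_assoc, mul_div_cancel₀ _ hp.ne']
    rw [htail]
    -- Discarding the failed outcomes drops nonnegative terms.
    exact ((List.filter_sublist.map _).sum_le_sum (hnn l)).trans (hfull l)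

/-- Mixing with a product state lowers the entanglement continuously to the target. -/
theorem exists_simplex_eq_target {E : Quantifier} (hE : IsMonotone E) {t : ℝ} {a b d : ℕ}
    (ha : d ≤ a) (hb : d ≤ b) (hd : 0 < d) (hcont : Continuous (E a b))
    (ht : hat E (diagVec fun _ : Fin 1 => 1) ≤ t) (μ : stdSimplex ℝ (Fin d)) (hμ : Antitone μ.1)
    (hμt : t ≤ hat E (diagVec μ.1)) :
    ∃ μ' : stdSimplex ℝ (Fin d), Antitone μ'.1 ∧ hat E (diagVec μ'.1) = t ∧
      ∀ l, tail l μ'.1 ≤ tail l μ.1 := by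
  let e : Fin d → ℝ := Pi.single ⟨0, hd⟩ 1
  have he : e ∈ stdSimplex ℝ (Fin d) := single_mem_stdSimplex ℝ _
  let γ : unitInterval → stdSimplex ℝ (Fin d) := fun s =>
    ⟨(1 - s.1) • μ.1 + s.1 • e, convex_stdSimplex ℝ _ μ.2 he (sub_nonneg.mpr s.2.2) s.2.1
      (sub_add_cancel _ _)⟩
  have hγ : Continuous γ := by
    refine Continuous.subtype_mk ?_ _
    fun_prop
  have hF : Continuous fun s => hat E (diagVec (γ s).1) := by
    have := hcont.comp ((continuous_stateOf ha hb).comp hγ)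
    refine this.congr fun s => ?_
    exact hE.eq_hat_stateOf ha hb (γ s)
  have h0 : t ≤ hat E (diagVec (γ 0).1) := by simpa [γ] using hμt
  have h1 : hat E (diagVec (γ 1).1) ≤ t := by
    simpa [γ, e, hE.hat_diagVec_single] using ht
  obtain ⟨s, hs⟩ := mem_range_of_exists_le_of_exists_ge hF ⟨1, h1⟩ ⟨0, h0⟩
  refine ⟨γ s, ?_, hs, fun l => ?_⟩
  · intro i j hij
    exact add_le_add (mul_le_mul_of_nonneg_left (hμ hij) (sub_nonneg.mpr s.2.2))
      (mul_le_mul_of_nonneg_left (antitone_single_zero hd hij) s.2.1)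
  -- The vertex `e` has no tail from `l ≥ 1` on, so mixing multiplies these tails by `1 - s`; the
  -- tail at `0` stays `1`.
  · simp only [γ, tail_add, tail_smul]
    rcases eq_or_ne l 0 with rfl | hl
    · rw [tail_zero, tail_zero, μ.2.2, he.2]
      linarith
    · rw [tail_single_zero hd hl]
      nlinarith [tail_nonneg μ.2.1 l, s.2.1]

/-! ### The lower bound -/

/-- Failures may end in a product state, so it is enough that `r • μ + (1 - r) • e` majorizes the
Schmidt vector of `Ψ`. The permutations from Rado's theorem need not be undone, since they do not
change `E`. -/
theorem exists_success_ge {E : Quantifier} (hE : IsMonotone E) {t r : ℝ} {a b : ℕ}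
    (Ψ : PureState a b) {d : ℕ} (hdef : schmidtRank Ψ = d) (hr0 : 0 ≤ r) (hr1 : r ≤ 1)
    (μ : stdSimplex ℝ (Fin d))
    (hμt : t ≤ hat E (diagVec μ.1))
    (htail : ∀ l, r * tail l μ.1 ≤ schmidtTail d Ψ l) :
    ∃ π : Protocol a b, r ≤ successProb E t π Ψ := by
  have hd := schmidtRank_pos Ψ
  have hb := schmidtRank_le_right Ψ
  rw [hdef] at hd hb
  let c : Fin d → ℝ := (schmidtVec Ψ hdef.le).1
  let e : Fin d → ℝ := Pi.single ⟨0, hd⟩ 1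
  have he : e ∈ stdSimplex ℝ (Fin d) := single_mem_stdSimplex ℝ _
  have hmix : c ∈ convexHull ℝ
      (Set.range fun σ : Equiv.Perm (Fin d) => (r • μ.1 + (1 - r) • e) ∘ σ) := by
    refine mem_convexHull_perm_of_tail_le (antitone_schmidtVec Ψ hdef.le) ?_ fun l => ?_
    · rw [← tail_zero, ← tail_zero, tail_add, tail_smul, tail_smul, tail_zero, tail_zero,
        tail_zero, μ.2.2, he.2, (schmidtVec Ψ hdef.le).2.2]
      ring
    · rw [tail_schmidtVec, tail_add, tail_smul, tail_smul]
      rcases eq_or_ne l 0 with rfl | hl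
      · rw [tail_zero, tail_zero, μ.2.2, he.2, schmidtTail_zero Ψ hdef.le]
        linarith
      · rw [tail_single_zero hd hl, mul_zero, add_zero]
        exact htail l
  obtain ⟨ι, _, w, z, hw0, hw1, hz, hsum⟩ := mem_convexHull_iff_exists_fintype.mp hmix
  choose σ hσ using hz
  have hperm : ∀ {x : Fin d → ℝ} (τ : Equiv.Perm (Fin d)), x ∈ stdSimplex ℝ (Fin d) →
      x ∘ τ ∈ stdSimplex ℝ (Fin d) := fun {x} τ hx =>
    ⟨fun i => hx.1 _, (Equiv.sum_comp τ x).trans hx.2⟩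
  -- Each permuted copy, of weight `w k`, is split into its `μ` part (success) and its vertex part
  -- (failure); the success weights `w k * r` sum to `r`.
  obtain ⟨π₀, hπ₀⟩ := exists_success_diagVec (E := E) (t := t) (c := c)
    (p := Sum.elim (fun k => w k * r) fun k => w k * (1 - r))
    (ν := Sum.elim (fun k => μ.1 ∘ σ k) fun k => e ∘ σ k)
    (by
      rintro (k | k)
      · exact mul_nonneg (hw0 k) hr0
      · exact mul_nonneg (hw0 k) (sub_nonneg.mpr hr1))
    (by
      simp only [Fintype.sum_sum_type, Sum.elim_inl, Sum.elim_inr, ← Finset.sum_mul, hw1]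
      ring)
    (by
      rintro (k | k)
      · exact hperm _ μ.2
      · exact hperm _ he)
    (by
      intro i
      rw [← hsum]
      simp only [Fintype.sum_sum_type, Sum.elim_inl, Sum.elim_inr, ← Finset.sum_add_distrib,
        Finset.sum_apply, Pi.smul_apply, smul_eq_mul]
      refine Finset.sum_congr rfl fun k _ => ?_
      rw [← hσ k]
      simp only [Function.comp_apply, Pi.add_apply, Pi.smul_apply, smul_eq_mul]
      ring)
    (by
      intro k
      simpa [hE.hat_diagVec_comp_perm] using hμt)
  simp only [Sum.elim_inl, ← Finset.sum_mul, hw1, one_mul] at hπ₀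
  obtain ⟨U, W, hU, hW, hUW⟩ := exists_schmidt_decomposition Ψ
  have hJ := basisMap_isometry (Fin.castLE_injective hb)
  have hJ' := conjTranspose_partialIsometry (partialIsometry_of_isometry hJ)
  set J := basisMap (Fin.castLE hb)
  -- Four local partial isometries, the last two cutting off the zero coefficients, bring `Ψ` to
  -- diagonal form of size `d`; the protocol is then pulled back through them in reverse order.
  have hdiag : applyB Jᴴ (applyA Jᴴ (applyA W (applyB U Ψ.1))) = diagVec c := by
    rw [hUW, ← place_castLE_diagVec hb fun i hi =>
      (schmidtCoeff_eq_zero_iff Ψ i).mpr (hdef.trans_le hi), place,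
      ← applyA_mul, hJ, applyA_one, ← applyB_mul, hJ, applyB_one]
    rfl
  rw [← hdiag] at hπ₀
  obtain ⟨π₁, h₁⟩ := exists_success_of_applyB (E := E) (t := t) hJ' _ π₀
  obtain ⟨π₂, h₂⟩ := exists_success_of_applyA (E := E) (t := t) hJ' _ π₁
  obtain ⟨π₃, h₃⟩ := exists_success_of_applyA (E := E) (t := t) hW _ π₂
  obtain ⟨π₄, h₄⟩ := exists_success_of_applyB (E := E) (t := t)
    (partialIsometry_of_isometry hU) _ π₃
  exact ⟨π₄, hπ₀.trans (h₁.trans (h₂.trans (h₃.trans h₄)))⟩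

/-! ### The optimum -/

/-- The conversion probabilities together with the Schmidt vectors of the targets. -/
def feasible (E : Quantifier) (t : ℝ) {a b : ℕ} (Ψ : PureState a b) :
    Set (unitInterval × stdSimplex ℝ (Fin (schmidtRank Ψ))) :=
  {x | Antitone x.2.1 ∧ hat E (diagVec x.2.1) = t ∧
    ∀ l, x.1.1 * tail l x.2.1 ≤ schmidtTail (schmidtRank Ψ) Ψ l}

/-- All conditions are closed in a compact product. Writing them as products avoids the tail ratios,
whose denominators may vanish; the continuity of `E a b` is transported to the simplex by `stateOf`.
-/
theorem isCompact_feasible {E : Quantifier} (hE : IsMonotone E) (t : ℝ) {a b : ℕ}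
    (Ψ : PureState a b) (hcont : Continuous (E a b)) : IsCompact (feasible E t Ψ) := by
  have hF : Continuous fun μ : stdSimplex ℝ (Fin (schmidtRank Ψ)) => hat E (diagVec μ.1) := by
    refine (hcont.comp (continuous_stateOf (schmidtRank_le_left Ψ)
      (schmidtRank_le_right Ψ))).congr fun μ => ?_
    exact hE.eq_hat_stateOf _ _ μ
  have h₁ : IsClosed {x : unitInterval × stdSimplex ℝ (Fin (schmidtRank Ψ)) | Antitone x.2.1} := by
    simp only [Antitone, Set.ofPred_forall]
    refine isClosed_iInter fun i => isClosed_iInter fun j => isClosed_iInter fun _ => ?_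
    have h : ∀ k, Continuous fun x : unitInterval × stdSimplex ℝ (Fin (schmidtRank Ψ)) =>
        x.2.1 k := fun k =>
      (continuous_apply k).comp (continuous_subtype_val.comp continuous_snd)
    exact isClosed_le (h j) (h i)
  have h₂ : IsClosed {x : unitInterval × stdSimplex ℝ (Fin (schmidtRank Ψ)) |
      hat E (diagVec x.2.1) = t} := isClosed_eq (hF.comp continuous_snd) continuous_const
  have h₃ : IsClosed {x : unitInterval × stdSimplex ℝ (Fin (schmidtRank Ψ)) |
      ∀ l, x.1.1 * tail l x.2.1 ≤ schmidtTail (schmidtRank Ψ) Ψ l} := by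
    simp only [Set.ofPred_forall]
    refine isClosed_iInter fun l => isClosed_le ?_ continuous_const
    exact (continuous_subtype_val.comp continuous_fst).mul
      ((continuous_tail l).comp (continuous_subtype_val.comp continuous_snd))
  exact (h₁.inter (h₂.inter h₃)).isCompact

theorem exists_feasible_of_success {E : Quantifier} (hE : IsMonotone E) {t : ℝ} {a b : ℕ}
    (Ψ : PureState a b) (hcont : Continuous (E a b))
    (ht : hat E (diagVec fun _ : Fin 1 => 1) ≤ t) (π : Protocol a b)
    (hp : 0 < successProb E t π Ψ) :
    ∃ x ∈ feasible E t Ψ, x.1.1 = successProb E t π Ψ := by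
  obtain ⟨μ, hμ, hμt, htail⟩ := exists_mean_schmidtVec hE Ψ π hp
  obtain ⟨μ', hμ', hμt', htail'⟩ := exists_simplex_eq_target hE (schmidtRank_le_left Ψ)
    (schmidtRank_le_right Ψ) (schmidtRank_pos Ψ) hcont ht μ hμ hμt
  have h1 : successProb E t π Ψ ≤ 1 := by
    have := htail 0
    rwa [tail_zero, μ.2.2, mul_one, schmidtTail_zero Ψ le_rfl] at this
  exact ⟨(⟨_, hp.le, h1⟩, μ'), ⟨hμ', hμt', fun l =>
    (mul_le_mul_of_nonneg_left (htail' l) hp.le).trans (htail l)⟩, rfl⟩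

theorem exists_feasible_of_mem_targetValues {E : Quantifier} (hE : IsMonotone E) {t q : ℝ}
    {a b : ℕ} (Ψ : PureState a b) (hq : q ∈ targetValues E t Ψ) :
    ∃ x ∈ feasible E t Ψ, x.1.1 = q := by
  obtain ⟨Ψ', hr, hEt, ⟨l₀, hl₀, hne, rfl⟩, hmin⟩ := hq
  set q := schmidtTail (schmidtRank Ψ) Ψ l₀ / schmidtTail (schmidtRank Ψ) Ψ' l₀
  have h0 : 0 ≤ q := div_nonneg (schmidtTail_nonneg _ _ _) (schmidtTail_nonneg _ _ _)
  have h1 : q ≤ 1 := by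
    -- The ratio at index `0` is `1 / 1`.
    refine hmin ⟨0, schmidtRank_pos Ψ, ?_, ?_⟩
    · simp [schmidtTail_zero Ψ' hr]
    · simp [schmidtTail_zero Ψ' hr, schmidtTail_zero Ψ le_rfl]
  refine ⟨(⟨q, h0, h1⟩, schmidtVec Ψ' hr), ⟨antitone_schmidtVec Ψ' hr, ?_, fun l => ?_⟩, rfl⟩
  · rw [← hEt, hE.eq_hat_diagVec Ψ' hr]
    rfl
  · change q * tail l (schmidtVec Ψ' hr).1 ≤ _
    rw [tail_schmidtVec]
    rcases (schmidtTail_nonneg (schmidtRank Ψ) Ψ' l).eq_or_lt with hz | hpos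
    · rw [← hz, mul_zero]
      exact schmidtTail_nonneg _ _ _
    · rcases lt_or_ge l (schmidtRank Ψ) with hl | hl
      · rw [← le_div_iff₀ hpos]
        exact hmin ⟨l, hl, hpos.ne', rfl⟩
      · simp [schmidtTail, Finset.Ico_eq_empty (not_lt.mpr hl)] at hpos

theorem exists_isLeast_tailRatios {a b : ℕ} (Ψ Ψ' : PureState a b)
    (hr : schmidtRank Ψ' ≤ schmidtRank Ψ) : ∃ q, IsLeast (tailRatios Ψ Ψ') q := by
  have hfin : (tailRatios Ψ Ψ').Finite := by
    refine ((Set.finite_Iio (schmidtRank Ψ)).image fun l =>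
      schmidtTail (schmidtRank Ψ) Ψ l / schmidtTail (schmidtRank Ψ) Ψ' l).subset ?_
    rintro q ⟨l, hl, -, rfl⟩
    exact ⟨l, hl, rfl⟩
  have hne : (tailRatios Ψ Ψ').Nonempty :=
    ⟨_, 0, schmidtRank_pos Ψ, by simp [schmidtTail_zero Ψ' hr], rfl⟩
  obtain ⟨q, hq, hmin⟩ := Set.exists_min_image _ id hfin hne
  exact ⟨q, hq, hmin⟩

/-- The minimal ratio is the largest admissible probability for its target state, so it is at least
the probability of the given pair. -/
theorem exists_mem_targetValues_ge {E : Quantifier} (hE : IsMonotone E) {t : ℝ} {a b : ℕ}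
    (Ψ : PureState a b) {x : unitInterval × stdSimplex ℝ (Fin (schmidtRank Ψ))}
    (hx : x ∈ feasible E t Ψ) : ∃ q ∈ targetValues E t Ψ, x.1.1 ≤ q := by
  have ha := schmidtRank_le_left Ψ
  have hb := schmidtRank_le_right Ψ
  let Ψ' : PureState a b := stateOf ha hb x.2
  have hr : schmidtRank Ψ' ≤ schmidtRank Ψ := schmidtRank_stateOf_le ha hb x.2
  obtain ⟨q, hq⟩ := exists_isLeast_tailRatios Ψ Ψ' hr
  refine ⟨q, ⟨Ψ', hr, (hE.eq_hat_stateOf ha hb x.2).trans hx.2.1, hq⟩, ?_⟩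
  obtain ⟨l, hl, hne, rfl⟩ := hq.1
  rw [le_div_iff₀ ((schmidtTail_nonneg _ _ _).lt_of_ne' hne)]
  refine le_trans (mul_le_mul_of_nonneg_left ?_ x.1.2.1) (hx.2.2 l)
  rw [schmidtTail_eq_of_rank_le Ψ' hr (schmidtRank_le_right _)]
  exact schmidtTail_stateOf_le ha hb x.2 l

end Entanglement

end

/-! ### Equality of the supremum and the maximum -/

theorem mainTheorem6 (E : Entanglement.Quantifier) (hE : Entanglement.IsMonotone E)
    (a b : ℕ) (Ψ : Entanglement.PureState a b)
    (hcont : Continuous (E a b))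
    (t : ℝ) (ht : ∃ (a₀ b₀ : ℕ) (Φ : Entanglement.PureState a₀ b₀), E a₀ b₀ Φ ≤ t) :
    ((∃ Ψ' : Entanglement.PureState a b,
        Entanglement.schmidtRank Ψ' ≤ Entanglement.schmidtRank Ψ ∧ E a b Ψ' = t) →
      ∃ M : ℝ,
        IsLUB (Set.range fun π : Entanglement.Protocol a b => Entanglement.successProb E t π Ψ) M ∧
        IsGreatest (Entanglement.targetValues E t Ψ) M) ∧
    ((¬ ∃ Ψ' : Entanglement.PureState a b,
        Entanglement.schmidtRank Ψ' ≤ Entanglement.schmidtRank Ψ ∧ E a b Ψ' = t) →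
      ∀ π : Entanglement.Protocol a b, Entanglement.successProb E t π Ψ = 0) := by
  open Entanglement in
  obtain ⟨a₀, b₀, Φ, hΦ⟩ := ht
  -- Product states minimise `E` across all dimensions, so the dimensions of `Φ` do not matter.
  have ht' := (hE.hat_product_le Φ).trans hΦ
  constructor
  · rintro ⟨Ψ', hr, hEt⟩
    obtain ⟨q₀, hq₀⟩ := exists_isLeast_tailRatios Ψ Ψ' hr
    obtain ⟨x₀, hx₀, -⟩ := exists_feasible_of_mem_targetValues hE Ψ
      (show q₀ ∈ targetValues E t Ψ from ⟨Ψ', hr, hEt, hq₀⟩)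
    obtain ⟨x, hx, hmax⟩ := (isCompact_feasible hE t Ψ hcont).exists_isMaxOn ⟨x₀, hx₀⟩
      (f := fun x => x.1.1) (continuous_subtype_val.comp continuous_fst).continuousOn
    refine ⟨x.1.1, ⟨?_, ?_⟩, ?_, ?_⟩
    · rintro _ ⟨π, rfl⟩
      rcases (success_nonneg (E := E) (t := t) π Ψ.1).eq_or_lt with h | h
      · exact h.symm.trans_le x.1.2.1
      · obtain ⟨y, hy, hyp⟩ := exists_feasible_of_success hE Ψ hcont ht' π h
        exact hyp.symm.trans_le (hmax hy)
    · intro u hu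
      obtain ⟨π, hπ⟩ := exists_success_ge hE Ψ rfl x.1.2.1 x.1.2.2 x.2 hx.2.1.ge hx.2.2
      exact hπ.trans (hu ⟨π, rfl⟩)
    · obtain ⟨q, hq, hxq⟩ := exists_mem_targetValues_ge hE Ψ hx
      obtain ⟨y, hy, hyq⟩ := exists_feasible_of_mem_targetValues hE Ψ hq
      -- The target value `q` is itself the probability of a feasible pair, so it cannot exceed the
      -- maximum.
      have : x.1.1 = q := le_antisymm hxq (hyq.symm.trans_le (hmax hy))
      rwa [this]
    · intro q hq
      obtain ⟨y, hy, hyq⟩ := exists_feasible_of_mem_targetValues hE Ψ hq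
      exact hyq.symm.trans_le (hmax hy)
  · intro hno π
    by_contra hne
    have hpos : 0 < successProb E t π Ψ :=
      (success_nonneg (E := E) (t := t) π Ψ.1).lt_of_ne' hne
    obtain ⟨x, hx, -⟩ := exists_feasible_of_success hE Ψ hcont ht' π hpos
    obtain ⟨q, ⟨Ψ', hr, hEt, -⟩, -⟩ := exists_mem_targetValues_ge hE Ψ hx
    exact hno ⟨Ψ', hr, hEt⟩
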